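/- Let $m\ge 1$ be an odd integer. Put $H_n=\sum_{j=1}^{n}\frac1j$ and $\varphi_k=\cos\frac{(2k+1)\pi}{m}$, let $\psi=\Gamma'/\Gamma$ on $(0,\infty)$ be the digamma function and $\psi'$ its derivative, and let the empty sum $\sum_{k=0}^{-1}(\cdot)$ be zero. Then the series below converges (as the limit of its partial sums over $1\le n\le N$, $N\to\infty$), and $$ \begin{aligned} &\sum_{n=1}^{\infty}(-1)^{n+1}H_n\sum_{p=0}^{m-1}\left[\frac{(-1)^p}{3mn+3p+1}+\frac{(-1)^p}{3mn+3p+2}\right]\\ &=\frac{m}{12}\left(\psi'(5/6)-\psi'(1/3)\right)-\frac{\pi^2m}{9}+\frac{\pi\sqrt3}{3}\log 3-\frac{\pi(m-1)\sqrt3}{9}\log 2\\ &\quad-\frac{2\pi\sqrt3}{9}\Bigg\{2\sum_{k=0}^{\frac{m-3}{2}}\log\left[\sin\left(\tfrac13\arcsin\sqrt{\tfrac{\varphi_k+1}{2}}\right)\right]-\sum_{k=0}^{\frac{m-3}{2}}\log\left[2\cos\left(\tfrac23\arcsin\sqrt{\tfrac{1+\varphi_k}{2}}\right)+1\right]-\sum_{k=0}^{\frac{m-3}{2}}\log(1+\varphi_k)\Bigg\}.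 \end{aligned} $$ -/

import Mathlib

/-- The digamma function `ψ(x) = Γ'(x) / Γ(x)` of a real variable (used for `x > 0`). -/
noncomputable def psi (x : ℝ) : ℝ := deriv Real.Gamma x / Real.Gamma x

/-- The derivative `ψ'` of the digamma function. -/
noncomputable def psiDeriv (x : ℝ) : ℝ := deriv psi x

/-- `φ_k = cos ((2k+1)π / m)`; the dependence on `m` is made explicit. -/
noncomputable def phi (m k : ℕ) : ℝ := Real.cos ((2 * (k : ℝ) + 1) * Real.pi / (m : ℝ))

/-- The closed form. For odd `m` the index set `Finset.range ((m - 1) / 2)` is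
`{0, …, (m - 3) / 2}`, which is empty for `m = 1`. -/
noncomputable def closedForm (m : ℕ) : ℝ :=
  (m : ℝ) / 12 * (psiDeriv (5 / 6) - psiDeriv (1 / 3)) - Real.pi ^ 2 * (m : ℝ) / 9
    + Real.pi * √3 / 3 * Real.log 3
    - Real.pi * ((m : ℝ) - 1) * √3 / 9 * Real.log 2
    - 2 * Real.pi * √3 / 9 *
      (2 * ∑ k ∈ Finset.range ((m - 1) / 2),
          Real.log (Real.sin (1 / 3 * Real.arcsin √((phi m k + 1) / 2)))
        - ∑ k ∈ Finset.range ((m - 1) / 2),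
          Real.log (2 * Real.cos (2 / 3 * Real.arcsin √((1 + phi m k) / 2)) + 1)
        - ∑ k ∈ Finset.range ((m - 1) / 2), Real.log (1 + phi m k))

/-- The `n`-th term of the series, `H_n` being Mathlib's `harmonic n`. -/
noncomputable def seriesTerm (m n : ℕ) : ℝ :=
  (-1) ^ (n + 1) * ((harmonic n : ℚ) : ℝ) *
    ∑ p ∈ Finset.range m,
      ((-1) ^ p / (3 * (m : ℝ) * (n : ℝ) + 3 * (p : ℝ) + 1)
        + (-1) ^ p / (3 * (m : ℝ) * (n : ℝ) + 3 * (p : ℝ) + 2))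

open Filter Topology Set

/-! Since 1/(1 - t + t²) = (1 + t)/(1 + t³), the inner sum over p is a truncated geometric series
integrated termwise: it equals K(3mn) + K(3m(n+1)), where K(j) is `kernelMoment j`
(`kernelMoment_add`). The alternating sign then allows summation by parts (`sum_seriesTerm`): H_n is
replaced by its increments 1/(n+1), the boundary term is O(log N / N), and the series becomes ∫₀¹
log(1 + t^(3m))/(1 - t + t²).

For odd m, 1 + s^m splits over ℝ into 1 + s and quadratics. At s = t³ the quadratics lead to J(u) =
∫₀¹ log(t⁶ + 2t³ cos u + 1)/(1 - t + t²) at u = π - (2k+1)π/m. Partial fractions give J'(u) in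
closed form, the derivative of (2π√3/3) log(1 + 2cos(u/3)) (`integral_log_sextic`). The constant
J(0) = 2∫₀¹ log(1 + t³)/(1 - t + t²) reduces through log-sine integrals to log 3 and L = ∫₀¹ log
t/(1 - t + t²) (`integral_log_one_add_cube_eq`). Finally L is an alternating sum of inverse squares,
evaluated by ψ' and a Fourier series (`integral_log_div_eq_psiDeriv`). -/

/-! ### The digamma function and the series for its derivative -/

theorem monotoneOn_psi : MonotoneOn psi (Ioi 0) := by
  have h := Real.convexOn_log_Gamma
  have hd : DifferentiableOn ℝ (Real.log ∘ Real.Gamma) (Ioi 0) := by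
    intro x hx
    exact ((Real.differentiableOn_Gamma_Ioi.differentiableAt (Ioi_mem_nhds hx)).log
      (Real.Gamma_pos_of_pos hx).ne').differentiableWithinAt
  have := h.monotoneOn_deriv (fun x hx => hd.differentiableAt (Ioi_mem_nhds hx))
  refine this.congr ?_
  intro x hx
  have h1 := (Real.differentiableOn_Gamma_Ioi.differentiableAt (Ioi_mem_nhds hx))
  exact (h1.hasDerivAt.log (Real.Gamma_pos_of_pos hx).ne').deriv

theorem psi_add_one {x : ℝ} (hx : 0 < x) : psi (x + 1) = psi x + x⁻¹ := by
  have h1 : HasDerivAt Real.Gamma (deriv Real.Gamma x) x :=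
    (Real.differentiableOn_Gamma_Ioi.differentiableAt (Ioi_mem_nhds hx)).hasDerivAt
  have h2 : HasDerivAt Real.Gamma (deriv Real.Gamma (x + 1)) (x + 1) :=
    (Real.differentiableOn_Gamma_Ioi.differentiableAt
      (Ioi_mem_nhds (by linarith : (0:ℝ) < x + 1))).hasDerivAt
  have h3 : HasDerivAt (fun y => Real.Gamma (y + 1)) (deriv Real.Gamma (x + 1)) x :=
    h2.comp_add_const x 1
  have h4 : HasDerivAt (fun y => y * Real.Gamma y)
      (1 * Real.Gamma x + x * deriv Real.Gamma x) x := (hasDerivAt_id x).mul h1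
  have h5 : (fun y => y * Real.Gamma y) =ᶠ[𝓝 x] (fun y => Real.Gamma (y + 1)) := by
    filter_upwards [Ioi_mem_nhds hx] with y hy
    exact (Real.Gamma_add_one (ne_of_gt hy)).symm
  have h6 := (h4.congr_of_eventuallyEq h5.symm).unique h3
  have h7 := (Real.Gamma_pos_of_pos hx).ne'
  unfold psi
  rw [Real.Gamma_add_one hx.ne', ← h6]
  field_simp
  ring

theorem psi_add_nat {x : ℝ} (hx : 0 < x) (N : ℕ) :
    psi (x + N) = psi x + ∑ n ∈ Finset.range N, ((n : ℝ) + x)⁻¹ := by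
  induction N with
  | zero => simp
  | succ k ih =>
    rw [Finset.sum_range_succ, ← add_assoc, ← ih]
    push_cast
    rw [← add_assoc, psi_add_one (by positivity), add_comm x]

theorem summable_inv_add_sq {c : ℝ} (hc : 0 < c) :
    Summable (fun n : ℕ => (((n : ℝ) + c) ^ 2)⁻¹) := by
  rw [← summable_nat_add_iff 1]
  have h := (summable_nat_add_iff 1).2 (Real.summable_nat_pow_inv.2 (by norm_num : 1 < 2))
  refine h.of_nonneg_of_le (fun n => by positivity) (fun n => ?_)
  push_cast
  exact inv_anti₀ (by positivity) (pow_le_pow_left₀ (by positivity) (by linarith) 2)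

theorem summable_inv_sub_inv {x : ℝ} (hx : 0 < x) (hx1 : x < 1) :
    Summable (fun n : ℕ => ((n : ℝ) + 1)⁻¹ - ((n : ℝ) + x)⁻¹) := by
  refine (summable_inv_add_sq hx).of_norm_bounded (fun n => ?_)
  have hp : 0 < (n : ℝ) + x := by positivity
  have h1 : ((n : ℝ) + 1)⁻¹ - ((n : ℝ) + x)⁻¹ = -((1 - x) / (((n : ℝ) + 1) * (n + x))) := by
    field_simp; ring
  rw [h1, norm_neg, Real.norm_eq_abs, abs_of_nonneg (div_nonneg (by linarith) (by positivity)),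
    ← one_div, div_le_div_iff₀ (by positivity) (by positivity)]
  nlinarith [mul_pos hx hp, mul_nonneg (by positivity : (0:ℝ) ≤ n) hp.le]

/-- Iterating the recurrence N times at x and at 1 leaves the remainder ψ(1+N) - ψ(x+N).
Monotonicity of ψ, from the log-convexity of Γ, puts it between 0 and ψ(N+1) - ψ(N) = 1/N. -/
theorem psi_eq_tsum {x : ℝ} (hx : 0 < x) (hx1 : x < 1) :
    psi x = psi 1 + ∑' n : ℕ, (((n : ℝ) + 1)⁻¹ - ((n : ℝ) + x)⁻¹) := by
  have h1 := (summable_inv_sub_inv hx hx1).hasSum.tendsto_sum_nat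
  have h2 : ∀ N : ℕ, ∑ n ∈ Finset.range N, (((n : ℝ) + 1)⁻¹ - ((n : ℝ) + x)⁻¹)
      = (psi x - psi 1) + (psi (1 + N) - psi (x + N)) := by
    intro N
    rw [psi_add_nat hx, psi_add_nat one_pos, Finset.sum_sub_distrib]
    ring
  have h3 : Tendsto (fun N : ℕ => psi (1 + N) - psi (x + N)) atTop (𝓝 0) := by
    refine squeeze_zero' ?_ ?_ (tendsto_inv_atTop_nhds_zero_nat (𝕜 := ℝ))
    · filter_upwards with N
      exact sub_nonneg.2 (monotoneOn_psi (by simp; positivity) (by simp; positivity) (by linarith))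
    · filter_upwards [eventually_gt_atTop 0] with N hN
      have hN' : (0:ℝ) < N := by exact_mod_cast hN
      have := monotoneOn_psi (a := (N:ℝ)) (b := x + N) hN' (by simp; positivity) (by linarith)
      have h4 := psi_add_one hN'
      rw [add_comm 1 (N:ℝ)]
      linarith
  simp_rw [h2] at h1
  have h4 := tendsto_nhds_unique h1 (tendsto_const_nhds.add h3)
  linarith

theorem hasSum_psiDeriv {x : ℝ} (hx : 0 < x) (hx1 : x < 1) :
    HasSum (fun n : ℕ => (((n : ℝ) + x) ^ 2)⁻¹) (psiDeriv x) := by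
  have h : HasDerivAt (fun y : ℝ => ∑' n : ℕ, (((n : ℝ) + 1)⁻¹ - ((n : ℝ) + y)⁻¹))
      (∑' n : ℕ, (((n : ℝ) + x) ^ 2)⁻¹) x := by
    refine hasDerivAt_tsum_of_isPreconnected
      (g := fun (n : ℕ) (y : ℝ) => ((n : ℝ) + 1)⁻¹ - ((n : ℝ) + y)⁻¹)
      (g' := fun (n : ℕ) (y : ℝ) => (((n : ℝ) + y) ^ 2)⁻¹)
      (u := fun n : ℕ => (((n : ℝ) + x / 2) ^ 2)⁻¹) (t := Ioo (x / 2) 1) (y₀ := x)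
      (summable_inv_add_sq (half_pos hx)) isOpen_Ioo isPreconnected_Ioo ?_ ?_
      ⟨by linarith, hx1⟩ (summable_inv_sub_inv hx hx1) ⟨by linarith, hx1⟩
    · intro n y hy
      have hy0 : (n : ℝ) + y ≠ 0 := by
        have : 0 < y := by linarith [hy.1]
        positivity
      have := (((hasDerivAt_id y).const_add (n : ℝ)).inv hy0).const_sub (((n : ℝ) + 1)⁻¹)
      convert! this using 1
      simp [neg_div]
    · intro n y hy
      have : 0 < y := by linarith [hy.1]
      rw [Real.norm_eq_abs, abs_of_nonneg (by positivity)]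
      gcongr
      exact hy.1.le
  have h2 : psi =ᶠ[𝓝 x] fun y => psi 1 + ∑' n : ℕ, (((n : ℝ) + 1)⁻¹ - ((n : ℝ) + y)⁻¹) := by
    filter_upwards [Ioo_mem_nhds hx hx1] with y hy
    exact psi_eq_tsum hy.1 hy.2
  have h3 : psiDeriv x = ∑' n : ℕ, (((n : ℝ) + x) ^ 2)⁻¹ :=
    ((h.const_add (psi 1)).congr_of_eventuallyEq h2).deriv
  rw [h3]
  exact (summable_inv_add_sq hx).hasSum

/-! ### Log-sine integrals and the integrals of log t and log(1 + t³) -/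

theorem integral_log_sin_two_mul (a : ℝ) :
    (∫ x in 0..(2 * a), Real.log (Real.sin x)) / 2
      = a * Real.log 2 + (∫ x in 0..a, Real.log (Real.sin x))
        + ∫ x in 0..a, Real.log (Real.cos x) := by
  have h : ∫ x in 0..a, Real.log (Real.sin (2 * x))
      = ∫ x in 0..a, (Real.log 2 + Real.log (Real.sin x) + Real.log (Real.cos x)) := by
    -- The logarithm of the product splits except at zeros of sin or cos, whose complement is
    -- codiscrete; hence no bound on a is needed.
    apply intervalIntegral.integral_congr_codiscreteWithin
    apply Filter.codiscreteWithin_mono (by tauto : uIoc 0 a ⊆ Set.univ)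
    have t₀ : Real.sin ⁻¹' {0}ᶜ ∈ Filter.codiscrete ℝ := by
      apply Real.analyticOnNhd_sin.preimage_zero_mem_codiscrete (x := Real.pi / 2)
      simp
    have t₁ : Real.cos ⁻¹' {0}ᶜ ∈ Filter.codiscrete ℝ := by
      apply Real.analyticOnNhd_cos.preimage_zero_mem_codiscrete (x := 0)
      simp
    filter_upwards [t₀, t₁] with y h₁ h₂
    have h₁' : Real.sin y ≠ 0 := h₁
    have h₂' : Real.cos y ≠ 0 := h₂
    rw [Real.sin_two_mul, Real.log_mul (by positivity) h₂', Real.log_mul two_ne_zero h₁']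
  have hs : IntervalIntegrable (fun x => Real.log (Real.sin x)) MeasureTheory.volume 0 a :=
    intervalIntegrable_log_sin
  have hc : IntervalIntegrable (fun x => Real.log (Real.cos x)) MeasureTheory.volume 0 a :=
    intervalIntegrable_log_cos
  rw [intervalIntegral.integral_add (intervalIntegrable_const.add hs) hc,
    intervalIntegral.integral_add intervalIntegrable_const hs, intervalIntegral.integral_const,
    intervalIntegral.integral_comp_mul_left (f := fun x ↦ Real.log (Real.sin x)) two_ne_zero] at h
  simp only [mul_zero, smul_eq_mul, sub_zero] at h
  linarith

/-- The relation between the values at `π/3` and `π/6` of the integrals of `log cos` and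
`log sin` behind the evaluation of `∫ log (1 + t ^ 3) / (1 - t + t ^ 2)`. -/
theorem integral_log_cos_log_sin_relation :
    (∫ x in 0..(Real.pi / 3), Real.log (Real.cos x))
      - 3 * (∫ x in 0..(Real.pi / 6), Real.log (Real.cos x))
      - 3 / 2 * (∫ x in 0..(Real.pi / 3), Real.log (Real.sin x))
      = 2 * Real.pi / 3 * Real.log 2 := by
  have hi : ∀ a b, IntervalIntegrable (fun x => Real.log (Real.sin x)) MeasureTheory.volume a b :=
    fun a b => intervalIntegrable_log_sin
  -- Duplication at π/3, the reflections x ↦ π - x and x ↦ π/2 - x, and the known integrals of log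
  -- sin over [0, π] and [0, π/2] express everything through ∫ log sin over [0, π/3], which then
  -- cancels.
  have h1 := integral_log_sin_two_mul (Real.pi / 3)
  have h3 := intervalIntegral.integral_comp_sub_left (a := 0) (b := Real.pi / 3)
    (fun x ↦ Real.log (Real.sin x)) Real.pi
  have h4 := intervalIntegral.integral_comp_sub_left (a := 0) (b := Real.pi / 6)
    (fun x ↦ Real.log (Real.sin x)) (Real.pi / 2)
  simp only [Real.sin_pi_sub, Real.sin_pi_div_two_sub, sub_zero] at h3 h4
  have h5 := intervalIntegral.integral_add_adjacent_intervals
    (hi 0 (2 * (Real.pi / 3))) (hi (2 * (Real.pi / 3)) Real.pi)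
  have h6 := intervalIntegral.integral_add_adjacent_intervals
    (hi 0 (Real.pi / 3)) (hi (Real.pi / 3) (Real.pi / 2))
  rw [integral_log_sin_zero_pi] at h5
  rw [integral_log_sin_zero_pi_div_two] at h6
  rw [show Real.pi - Real.pi / 3 = 2 * (Real.pi / 3) by ring] at h3
  rw [show Real.pi / 2 - Real.pi / 6 = Real.pi / 3 by ring] at h4
  rw [h4]
  linarith

theorem one_sub_add_sq_pos (t : ℝ) : 0 < 1 - t + t ^ 2 := by nlinarith [sq_nonneg (t - 1 / 2)]

theorem cos_pos_of_mem_Icc_pi_div_six {x : ℝ}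
    (hx : x ∈ Icc (-(Real.pi / 6)) (Real.pi / 6)) : 0 < Real.cos x :=
  Real.cos_pos_of_mem_Ioo ⟨by linarith [hx.1, Real.pi_pos], by linarith [hx.2, Real.pi_pos]⟩

theorem sin_add_pi_div_six (x : ℝ) :
    Real.sin (x + Real.pi / 6) = √3 / 2 * Real.sin x + 1 / 2 * Real.cos x := by
  rw [Real.sin_add, Real.cos_pi_div_six, Real.sin_pi_div_six]
  ring

theorem sin_add_pi_div_six_quadratic (x : ℝ) :
    Real.cos x ^ 2 - Real.sin (x + Real.pi / 6) * Real.cos x + Real.sin (x + Real.pi / 6) ^ 2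
      = 3 / 4 := by
  have h3 : √3 ^ 2 = 3 := Real.sq_sqrt (by norm_num)
  rw [sin_add_pi_div_six]
  linear_combination 3 / 4 * Real.sin_sq_add_cos_sq x + Real.sin x ^ 2 / 4 * h3

/-- The substitution `t = sin (x + π/6) / cos x`. -/
theorem integral_div_one_sub_add_sq (f : ℝ → ℝ) :
    ∫ t in (0 : ℝ)..1, f t / (1 - t + t ^ 2)
      = 2 / √3 * ∫ x in (-(Real.pi / 6))..(Real.pi / 6),
          f (Real.sin (x + Real.pi / 6) / Real.cos x) := by
  have hle : -(Real.pi / 6) ≤ Real.pi / 6 := by linarith [Real.pi_pos]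
  have h3 : √3 ^ 2 = 3 := Real.sq_sqrt (by norm_num)
  have h3p : 0 < √3 := by positivity
  have hd : ∀ x ∈ Icc (-(Real.pi / 6)) (Real.pi / 6),
      HasDerivAt (fun x => Real.sin (x + Real.pi / 6) / Real.cos x)
        (√3 / 2 / Real.cos x ^ 2) x := by
    intro x hx
    have hc := cos_pos_of_mem_Icc_pi_div_six hx
    convert! ((Real.hasDerivAt_sin (x + Real.pi / 6)).comp_add_const x (Real.pi / 6)).div
      (Real.hasDerivAt_cos x) hc.ne' using 1
    rw [← Real.cos_pi_div_six, show Real.pi / 6 = x + Real.pi / 6 - x by ring, Real.cos_sub]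
    ring_nf
  -- A monotone substitution asks nothing of f, so f = log with its singularity at 0 is covered.
  have key := intervalIntegral.integral_comp_mul_deriv_of_deriv_nonneg
    (a := -(Real.pi / 6)) (b := Real.pi / 6)
    (f := fun x => Real.sin (x + Real.pi / 6) / Real.cos x)
    (f' := fun x => √3 / 2 / Real.cos x ^ 2) (g := fun t => f t / (1 - t + t ^ 2))
    (by
      rw [uIcc_of_le hle]
      exact fun x hx => (hd x hx).continuousAt.continuousWithinAt)
    (by
      rw [min_eq_left hle, max_eq_right hle]
      exact fun x hx => hd x (Ioo_subset_Icc_self hx))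
    (fun x _ => by positivity)
  have e0 : Real.sin (-(Real.pi / 6) + Real.pi / 6) / Real.cos (-(Real.pi / 6)) = 0 := by simp
  have e1 : Real.sin (Real.pi / 6 + Real.pi / 6) / Real.cos (Real.pi / 6) = 1 := by
    rw [show Real.pi / 6 + Real.pi / 6 = Real.pi / 3 by ring, Real.sin_pi_div_three,
      Real.cos_pi_div_six, div_self (by positivity)]
  simp only [e0, e1] at key
  rw [← key, ← intervalIntegral.integral_const_mul]
  refine intervalIntegral.integral_congr fun x hx => ?_
  rw [uIcc_of_le hle] at hx
  have hc := cos_pos_of_mem_Icc_pi_div_six hx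
  have hq := sin_add_pi_div_six_quadratic x
  simp only [Function.comp_apply]
  set s := Real.sin (x + Real.pi / 6)
  set c := Real.cos x
  have e2 : 1 - s / c + (s / c) ^ 2 = 3 / 4 / c ^ 2 := by
    rw [← hq]
    field_simp
  rw [e2]
  field_simp
  linear_combination 4 * f (s / c) * h3

theorem integral_log_cos_symm (a : ℝ) :
    ∫ x in (-a)..a, Real.log (Real.cos x) = 2 * ∫ x in 0..a, Real.log (Real.cos x) := by
  have hi : ∀ a b, IntervalIntegrable (fun x => Real.log (Real.cos x)) MeasureTheory.volume a b :=
    fun a b => intervalIntegrable_log_cos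
  have h := intervalIntegral.integral_comp_neg (a := 0) (b := a)
    (fun x ↦ Real.log (Real.cos x))
  simp only [Real.cos_neg, neg_zero] at h
  rw [← intervalIntegral.integral_add_adjacent_intervals (hi (-a) 0) (hi 0 a), ← h]
  ring

theorem integral_log_div_one_sub_add_sq :
    ∫ t in (0 : ℝ)..1, Real.log t / (1 - t + t ^ 2)
      = 2 / √3 * ((∫ x in 0..(Real.pi / 3), Real.log (Real.sin x))
        - 2 * ∫ x in 0..(Real.pi / 6), Real.log (Real.cos x)) := by
  have hle : -(Real.pi / 6) ≤ Real.pi / 6 := by linarith [Real.pi_pos]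
  have hs : IntervalIntegrable (fun x => Real.log (Real.sin (x + Real.pi / 6)))
      MeasureTheory.volume (-(Real.pi / 6)) (Real.pi / 6) := by
    have : IntervalIntegrable (fun x => Real.log (Real.sin x))
      MeasureTheory.volume (-(Real.pi / 6) + Real.pi / 6) (Real.pi / 6 + Real.pi / 6) :=
      intervalIntegrable_log_sin
    simpa using this.comp_add_right (Real.pi / 6)
  have hc : IntervalIntegrable (fun x => Real.log (Real.cos x))
      MeasureTheory.volume (-(Real.pi / 6)) (Real.pi / 6) := intervalIntegrable_log_cos
  have e : ∫ x in (-(Real.pi / 6))..(Real.pi / 6),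
        Real.log (Real.sin (x + Real.pi / 6) / Real.cos x)
      = ∫ x in (-(Real.pi / 6))..(Real.pi / 6),
        (Real.log (Real.sin (x + Real.pi / 6)) - Real.log (Real.cos x)) := by
    -- Only almost everywhere: at x = -π/6 the sine vanishes and, with log 0 = 0, the splitting
    -- fails.
    refine intervalIntegral.integral_congr_ae (Filter.Eventually.of_forall fun x hx => ?_)
    rw [uIoc_of_le hle] at hx
    have hcx := cos_pos_of_mem_Icc_pi_div_six (Ioc_subset_Icc_self hx)
    have hsx : 0 < Real.sin (x + Real.pi / 6) :=
      Real.sin_pos_of_pos_of_lt_pi (by linarith [hx.1]) (by linarith [hx.2, Real.pi_pos])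
    exact Real.log_div hsx.ne' hcx.ne'
  rw [integral_div_one_sub_add_sq, e, intervalIntegral.integral_sub hs hc,
    integral_log_cos_symm,
    intervalIntegral.integral_comp_add_right (fun x => Real.log (Real.sin x)),
    neg_add_cancel, show Real.pi / 6 + Real.pi / 6 = Real.pi / 3 by ring]

/-- Under the substitution, 1 + t = √3 cos(x - π/6)/cos x and 1 - t + t² = 3/(4 cos² x), so 1 + t³
is a monomial in cosines and its logarithm splits. -/
theorem integral_log_one_add_cube_div_one_sub_add_sq :
    ∫ t in (0 : ℝ)..1, Real.log (1 + t ^ 3) / (1 - t + t ^ 2)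
      = 2 / √3 * (Real.pi / 3 * (3 / 2 * Real.log 3 - 2 * Real.log 2)
        + (∫ x in 0..(Real.pi / 3), Real.log (Real.cos x))
        - 6 * ∫ x in 0..(Real.pi / 6), Real.log (Real.cos x)) := by
  have hle : -(Real.pi / 6) ≤ Real.pi / 6 := by linarith [Real.pi_pos]
  have hs : IntervalIntegrable (fun x => Real.log (Real.cos (x - Real.pi / 6)))
      MeasureTheory.volume (-(Real.pi / 6)) (Real.pi / 6) := by
    have : IntervalIntegrable (fun x => Real.log (Real.cos x))
      MeasureTheory.volume (-(Real.pi / 6) - Real.pi / 6) (Real.pi / 6 - Real.pi / 6) :=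
      intervalIntegrable_log_cos
    simpa using this.comp_sub_right (Real.pi / 6)
  have hc : IntervalIntegrable (fun x => Real.log (Real.cos x))
      MeasureTheory.volume (-(Real.pi / 6)) (Real.pi / 6) := intervalIntegrable_log_cos
  have e : ∫ x in (-(Real.pi / 6))..(Real.pi / 6),
        Real.log (1 + (Real.sin (x + Real.pi / 6) / Real.cos x) ^ 3)
      = ∫ x in (-(Real.pi / 6))..(Real.pi / 6),
        (((3 / 2 * Real.log 3 - 2 * Real.log 2) + Real.log (Real.cos (x - Real.pi / 6)))
          - 3 * Real.log (Real.cos x)) := by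
    refine intervalIntegral.integral_congr fun x hx => ?_
    rw [uIcc_of_le hle] at hx
    have hcx := cos_pos_of_mem_Icc_pi_div_six hx
    have hcy : 0 < Real.cos (x - Real.pi / 6) :=
      Real.cos_pos_of_mem_Ioo ⟨by linarith [hx.1, Real.pi_pos], by linarith [hx.2, Real.pi_pos]⟩
    have h3 : √3 ^ 2 = 3 := Real.sq_sqrt (by norm_num)
    have h3p : 0 < √3 := by positivity
    have hsum : Real.cos x + Real.sin (x + Real.pi / 6) = √3 * Real.cos (x - Real.pi / 6) := by
      rw [sin_add_pi_div_six, Real.cos_sub, Real.cos_pi_div_six, Real.sin_pi_div_six]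
      linear_combination -Real.cos x / 2 * h3
    have hq := sin_add_pi_div_six_quadratic x
    have hf : 1 + (Real.sin (x + Real.pi / 6) / Real.cos x) ^ 3
        = √3 ^ 3 * Real.cos (x - Real.pi / 6) / (2 ^ 2 * Real.cos x ^ 3) := by
      have : √3 ^ 3 * Real.cos (x - Real.pi / 6)
          = 4 * (Real.cos x ^ 3 + Real.sin (x + Real.pi / 6) ^ 3) := by
        linear_combination √3 * Real.cos (x - Real.pi / 6) * h3 - 3 * hsum
          - 4 * (Real.cos x + Real.sin (x + Real.pi / 6)) * hq
      rw [this]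
      generalize Real.sin (x + Real.pi / 6) = s
      field_simp
      ring
    rw [hf, Real.log_div (by positivity) (by positivity), Real.log_mul (by positivity) hcy.ne',
      Real.log_mul (by positivity) (by positivity), Real.log_pow, Real.log_pow, Real.log_pow,
      Real.log_sqrt (by norm_num)]
    push_cast
    ring
  have h0 := intervalIntegral.integral_comp_neg (a := 0) (b := Real.pi / 3)
    (fun x ↦ Real.log (Real.cos x))
  simp only [Real.cos_neg, neg_zero] at h0
  rw [integral_div_one_sub_add_sq (fun t => Real.log (1 + t ^ 3)), e,
    intervalIntegral.integral_sub (intervalIntegrable_const.add hs) (hc.const_mul 3),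
    intervalIntegral.integral_add intervalIntegrable_const hs,
    intervalIntegral.integral_const_mul, integral_log_cos_symm, intervalIntegral.integral_const,
    intervalIntegral.integral_comp_sub_right (fun x => Real.log (Real.cos x)),
    sub_self, show -(Real.pi / 6) - Real.pi / 6 = -(Real.pi / 3) by ring, ← h0, smul_eq_mul]
  ring

theorem integral_log_one_add_cube_eq :
    ∫ t in (0 : ℝ)..1, Real.log (1 + t ^ 3) / (1 - t + t ^ 2)
      = Real.pi / √3 * Real.log 3
        + 3 / 2 * ∫ t in (0 : ℝ)..1, Real.log t / (1 - t + t ^ 2) := by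
  rw [integral_log_div_one_sub_add_sq, integral_log_one_add_cube_div_one_sub_add_sq]
  linear_combination 2 / √3 * integral_log_cos_log_sin_relation

/-! ### Partial fractions and the integral with parameter u -/

/-- With y = t + 1/t, each quadratic is t(y - wᵢ), and the hypotheses say that the wᵢ are the roots
of y³ - 3y - w₁w₂w₃. The numerator is 3t²(y + 2)(y - 1), so the residue at w is 3(w + 2)(w - 1)/(3w²
- 3) = (w + 2)/(w + 1). -/
theorem partialFraction_cubic {w₁ w₂ w₃ t q₁ q₂ q₃ : ℝ}
    (hs : w₁ + w₂ + w₃ = 0) (hw : w₁ ^ 2 + w₁ * w₂ + w₂ ^ 2 = 3)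
    (hq₁ : q₁ = t ^ 2 - w₁ * t + 1) (hq₂ : q₂ = t ^ 2 - w₂ * t + 1) (hq₃ : q₃ = t ^ 2 - w₃ * t + 1)
    (h₁ : w₁ + 1 ≠ 0) (h₂ : w₂ + 1 ≠ 0) (h₃ : w₃ + 1 ≠ 0)
    (hq₁' : q₁ ≠ 0) (hq₂' : q₂ ≠ 0) (hq₃' : q₃ ≠ 0) :
    (w₁ + 2) / (w₁ + 1) / q₁ + (w₂ + 2) / (w₂ + 1) / q₂ + (w₃ + 2) / (w₃ + 1) / q₃
      = 3 * (1 + t) * (1 + t ^ 3) / (q₁ * q₂ * q₃) := by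
  have key : (w₁ + 2) * (w₂ + 1) * (w₃ + 1) * (q₂ * q₃)
      + (w₂ + 2) * (w₁ + 1) * (w₃ + 1) * (q₁ * q₃)
      + (w₃ + 2) * (w₁ + 1) * (w₂ + 1) * (q₁ * q₂)
      = 3 * (1 + t) * (1 + t ^ 3) * ((w₁ + 1) * (w₂ + 1) * (w₃ + 1)) := by
    obtain rfl : w₃ = -w₁ - w₂ := by linarith
    rw [hq₁, hq₂, hq₃]
    linear_combination (w₁ ^ 2 * w₂ * t ^ 2 + 2 * w₁ ^ 2 * t ^ 2 + w₁ * w₂ ^ 2 * t ^ 2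
      + 2 * w₁ * w₂ * t ^ 2 + 2 * w₂ ^ 2 * t ^ 2 - t ^ 4 + t ^ 3 - 4 * t ^ 2 + t - 1) * hw
  field_simp
  linear_combination key

theorem prod_quadratic_cubic {w₁ w₂ w₃ t : ℝ}
    (hs : w₁ + w₂ + w₃ = 0) (hw : w₁ ^ 2 + w₁ * w₂ + w₂ ^ 2 = 3) :
    (t ^ 2 - w₁ * t + 1) * (t ^ 2 - w₂ * t + 1) * (t ^ 2 - w₃ * t + 1)
      = t ^ 6 - w₁ * w₂ * w₃ * t ^ 3 + 1 := by
  obtain rfl : w₃ = -w₁ - w₂ := by linarith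
  linear_combination -(t ^ 4 + t ^ 2) * hw

theorem quadratic_cos_pos {α : ℝ} (h0 : 0 < α) (h1 : α < Real.pi) (t : ℝ) :
    0 < t ^ 2 - 2 * Real.cos α * t + 1 := by
  have hs := Real.sin_pos_of_pos_of_lt_pi h0 h1
  nlinarith [sq_nonneg (t - Real.cos α), Real.sin_sq_add_cos_sq α]

theorem integral_inv_quadratic_cos {α : ℝ} (h0 : 0 < α) (h1 : α < Real.pi) :
    ∫ t in (0 : ℝ)..1, (t ^ 2 - 2 * Real.cos α * t + 1)⁻¹
      = (Real.pi - α) / (2 * Real.sin α) := by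
  have hs := Real.sin_pos_of_pos_of_lt_pi h0 h1
  have hd : ∀ t : ℝ, HasDerivAt
      (fun t => Real.arctan ((t - Real.cos α) / Real.sin α) / Real.sin α)
      ((t ^ 2 - 2 * Real.cos α * t + 1)⁻¹) t := by
    intro t
    have hq := quadratic_cos_pos h0 h1 t
    convert! ((((hasDerivAt_id t).sub_const (Real.cos α)).div_const (Real.sin α)).arctan).div_const
      (Real.sin α) using 1
    have : 1 + ((t - Real.cos α) / Real.sin α) ^ 2
        = (t ^ 2 - 2 * Real.cos α * t + 1) / Real.sin α ^ 2 := by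
      field_simp
      linear_combination Real.sin_sq_add_cos_sq α
    simp only [id]
    rw [this]
    field_simp
  have hcont : Continuous fun t : ℝ => (t ^ 2 - 2 * Real.cos α * t + 1)⁻¹ :=
    Continuous.inv₀ (by fun_prop) (fun t => (quadratic_cos_pos h0 h1 t).ne')
  rw [intervalIntegral.integral_eq_sub_of_hasDerivAt (fun t _ => hd t)
    (hcont.intervalIntegrable _ _)]
  have hh : 0 < Real.cos (α / 2) := Real.cos_pos_of_mem_Ioo ⟨by linarith, by linarith⟩
  have hh' : 0 < Real.sin (α / 2) := Real.sin_pos_of_pos_of_lt_pi (by linarith) (by linarith)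
  have e1 : (1 - Real.cos α) / Real.sin α = Real.tan (α / 2) := by
    have h := Real.sin_two_mul (α / 2)
    have h' := Real.cos_sq' (α / 2)
    have h'' := Real.cos_two_mul (α / 2)
    rw [mul_div_cancel₀ _ two_ne_zero] at h h''
    rw [h, h'', Real.tan_eq_sin_div_cos]
    field_simp
    linear_combination -2 * h'
  have e2 : (0 - Real.cos α) / Real.sin α = Real.tan (α - Real.pi / 2) := by
    rw [Real.tan_eq_sin_div_cos, Real.sin_sub_pi_div_two, Real.cos_sub_pi_div_two, zero_sub]
  rw [e1, e2, Real.arctan_tan (by linarith) (by linarith),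
    Real.arctan_tan (by linarith) (by linarith)]
  field_simp
  ring

/-- The sextic is a convex combination of (1 + t³)² and (1 - t³)². The bound is uniform in t, as
differentiation under the integral requires. -/
theorem add_one_div_two_le_sextic {c t : ℝ} (hc : -1 < c) (hc1 : c ≤ 1) (ht : 0 ≤ t) :
    (1 + c) / 2 ≤ t ^ 6 + 2 * t ^ 3 * c + 1 := by
  have h3 : 0 ≤ t ^ 3 := by positivity
  have e : t ^ 6 + 2 * t ^ 3 * c + 1
      = (1 + c) / 2 * (1 + t ^ 3) ^ 2 + (1 - c) / 2 * (1 - t ^ 3) ^ 2 := by ring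
  rw [e]
  nlinarith [mul_nonneg (by linarith : 0 ≤ 1 - c) (sq_nonneg (1 - t ^ 3)),
    mul_nonneg (by linarith : 0 ≤ 1 + c) h3, mul_nonneg (by linarith : 0 ≤ 1 + c) (sq_nonneg (t ^ 3))]

theorem half_angle_coefficient {h : ℝ} (hs : Real.sin h ≠ 0) (hc : Real.cos h ≠ 0)
    (h3 : 2 * Real.cos (2 * h) + 1 ≠ 0) :
    (2 * Real.cos (2 * h) + 2) / (2 * Real.cos (2 * h) + 1) / (2 * Real.sin (2 * h))
      = Real.cos h / Real.sin (3 * h) := by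
  have e : Real.sin (3 * h) = Real.sin h * (2 * Real.cos (2 * h) + 1) := by
    rw [Real.sin_three_mul, Real.cos_two_mul, Real.cos_sq']
    ring
  rw [e, Real.sin_two_mul, show 2 * Real.cos (2 * h) + 2 = 4 * Real.cos h ^ 2 by
    rw [Real.cos_two_mul]; ring]
  field_simp
  norm_num

/-- The integral over `[0, 1]` of the rational function with denominator
`t ^ 6 + 2 t ^ 3 cos (6 p) + 1`. -/
theorem integral_cubic_kernel {p : ℝ} (h0 : 0 < p) (h1 : p < Real.pi / 6) :
    ∫ t in (0 : ℝ)..1, (1 + t) * (1 + t ^ 3) / (t ^ 6 + 2 * t ^ 3 * Real.cos (6 * p) + 1)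
      = 2 * Real.pi * √3 / 9 * (Real.cos p / Real.cos (3 * p)) := by
  have hpi := Real.pi_pos
  have h3 : √3 ^ 2 = 3 := Real.sq_sqrt (by norm_num)
  -- The three angles satisfy cos 3α = -cos 6p, so by the triple-angle formula the numbers 2cos α
  -- are the roots of w³ - 3w + 2cos 6p.
  set α₁ := 2 * (Real.pi / 6 - p) with hα₁
  set α₂ := 2 * (Real.pi / 2 - p) with hα₂
  set α₃ := 2 * (Real.pi / 6 + p) with hα₃
  have b₁ : 0 < α₁ ∧ α₁ < Real.pi := ⟨by linarith, by linarith⟩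
  have b₂ : 0 < α₂ ∧ α₂ < Real.pi := ⟨by linarith, by linarith⟩
  have b₃ : 0 < α₃ ∧ α₃ < Real.pi := ⟨by linarith, by linarith⟩
  have c₁ : Real.cos α₁ = 1 / 2 * Real.cos (2 * p) + √3 / 2 * Real.sin (2 * p) := by
    rw [show α₁ = Real.pi / 3 - 2 * p by rw [hα₁]; ring, Real.cos_sub, Real.cos_pi_div_three,
      Real.sin_pi_div_three]
  have c₂ : Real.cos α₂ = -Real.cos (2 * p) := by
    rw [show α₂ = Real.pi - 2 * p by rw [hα₂]; ring, Real.cos_pi_sub]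
  have c₃ : Real.cos α₃ = 1 / 2 * Real.cos (2 * p) - √3 / 2 * Real.sin (2 * p) := by
    rw [show α₃ = Real.pi / 3 + 2 * p by rw [hα₃]; ring, Real.cos_add, Real.cos_pi_div_three,
      Real.sin_pi_div_three]
  have hsc := Real.sin_sq_add_cos_sq (2 * p)
  have hsum : 2 * Real.cos α₁ + 2 * Real.cos α₂ + 2 * Real.cos α₃ = 0 := by
    rw [c₁, c₂, c₃]; ring
  have hw : (2 * Real.cos α₁) ^ 2 + 2 * Real.cos α₁ * (2 * Real.cos α₂) + (2 * Real.cos α₂) ^ 2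
      = 3 := by
    rw [c₁, c₂]
    linear_combination Real.sin (2 * p) ^ 2 * h3 + 3 * hsc
  have hprod : 2 * Real.cos α₁ * (2 * Real.cos α₂) * (2 * Real.cos α₃)
      = -(2 * Real.cos (6 * p)) := by
    rw [c₁, c₂, c₃, show 6 * p = 3 * (2 * p) by ring, Real.cos_three_mul]
    linear_combination 2 * Real.cos (2 * p) * Real.sin (2 * p) ^ 2 * h3
      + 6 * Real.cos (2 * p) * hsc
  have n₁ : 2 * Real.cos α₁ + 1 ≠ 0 := by
    have : 0 < Real.cos α₁ := Real.cos_pos_of_mem_Ioo ⟨by linarith, by linarith⟩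
    positivity
  have n₂ : 2 * Real.cos α₂ + 1 ≠ 0 := by
    have := Real.cos_lt_cos_of_nonneg_of_le_pi (x := 2 * p) (y := Real.pi / 3) (by linarith)
      (by linarith) (by linarith)
    rw [Real.cos_pi_div_three] at this
    rw [c₂]
    linarith
  have n₃ : 2 * Real.cos α₃ + 1 ≠ 0 := by
    have := Real.cos_lt_cos_of_nonneg_of_le_pi (x := α₃) (y := Real.pi - Real.pi / 3) (by linarith)
      (by linarith) (by linarith)
    rw [Real.cos_pi_sub, Real.cos_pi_div_three] at this
    linarith
  have hi : ∀ α, 0 < α ∧ α < Real.pi → ∀ c : ℝ, IntervalIntegrable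
      (fun t : ℝ => c * (t ^ 2 - 2 * Real.cos α * t + 1)⁻¹) MeasureTheory.volume 0 1 := by
    intro α hα c
    refine Continuous.intervalIntegrable ?_ _ _
    exact continuous_const.mul
      (Continuous.inv₀ (by fun_prop) (fun t => (quadratic_cos_pos hα.1 hα.2 t).ne'))
  have e : ∀ t : ℝ, (1 + t) * (1 + t ^ 3) / (t ^ 6 + 2 * t ^ 3 * Real.cos (6 * p) + 1)
      = (2 * Real.cos α₁ + 2) / (2 * Real.cos α₁ + 1) / 3 * (t ^ 2 - 2 * Real.cos α₁ * t + 1)⁻¹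
      + (2 * Real.cos α₂ + 2) / (2 * Real.cos α₂ + 1) / 3 * (t ^ 2 - 2 * Real.cos α₂ * t + 1)⁻¹
      + (2 * Real.cos α₃ + 2) / (2 * Real.cos α₃ + 1) / 3 *
        (t ^ 2 - 2 * Real.cos α₃ * t + 1)⁻¹ := by
    intro t
    have hpf := partialFraction_cubic (t := t) hsum hw rfl rfl rfl n₁ n₂ n₃
      (quadratic_cos_pos b₁.1 b₁.2 t).ne' (quadratic_cos_pos b₂.1 b₂.2 t).ne'
      (quadratic_cos_pos b₃.1 b₃.2 t).ne'
    rw [prod_quadratic_cubic hsum hw, hprod] at hpf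
    rw [show t ^ 6 + 2 * t ^ 3 * Real.cos (6 * p) + 1
      = t ^ 6 - -(2 * Real.cos (6 * p)) * t ^ 3 + 1 by ring]
    linear_combination -1 / 3 * hpf
  simp only [e]
  rw [intervalIntegral.integral_add ((hi _ b₁ _).add (hi _ b₂ _)) (hi _ b₃ _),
    intervalIntegral.integral_add (hi _ b₁ _) (hi _ b₂ _)]
  simp only [intervalIntegral.integral_const_mul]
  rw [integral_inv_quadratic_cos b₁.1 b₁.2, integral_inv_quadratic_cos b₂.1 b₂.2,
    integral_inv_quadratic_cos b₃.1 b₃.2]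
  have hcoef : ∀ h, 0 < h → h < Real.pi / 2 → 2 * Real.cos (2 * h) + 1 ≠ 0 →
      (2 * Real.cos (2 * h) + 2) / (2 * Real.cos (2 * h) + 1) / (2 * Real.sin (2 * h))
      = Real.cos h / Real.sin (3 * h) := fun h hh hh' hne =>
    half_angle_coefficient (Real.sin_pos_of_pos_of_lt_pi hh (by linarith)).ne'
      (Real.cos_pos_of_mem_Ioo ⟨by linarith, by linarith⟩).ne' hne
  have k₁ := hcoef _ (by linarith) (by linarith) n₁
  have k₂ := hcoef _ (by linarith) (by linarith) n₂
  have k₃ := hcoef _ (by linarith) (by linarith) n₃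
  rw [show 3 * (Real.pi / 6 - p) = Real.pi / 2 - 3 * p by ring, Real.sin_pi_div_two_sub,
    Real.cos_sub, Real.cos_pi_div_six, Real.sin_pi_div_six] at k₁
  rw [show 3 * (Real.pi / 2 - p) = Real.pi / 2 - 3 * p + Real.pi by ring, Real.sin_add_pi,
    Real.sin_pi_div_two_sub, Real.cos_pi_div_two_sub] at k₂
  rw [show 3 * (Real.pi / 6 + p) = 3 * p + Real.pi / 2 by ring, Real.sin_add_pi_div_two,
    Real.cos_add, Real.cos_pi_div_six, Real.sin_pi_div_six] at k₃
  have r : ∀ A S X : ℝ, A / 3 * (X / S) = X / 3 * (A / S) := fun A S X => by ring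
  rw [r _ (2 * Real.sin α₁), r _ (2 * Real.sin α₂), r _ (2 * Real.sin α₃), k₁, k₂, k₃,
    hα₁, hα₂, hα₃]
  have hD : 0 < Real.cos (3 * p) := Real.cos_pos_of_mem_Ioo ⟨by linarith, by linarith⟩
  -- In the sum weighted by π - αᵢ the terms with p as a factor outside the trigonometric functions
  -- cancel.
  field_simp
  ring

theorem integral_inv_one_sub_add_sq :
    ∫ t in (0 : ℝ)..1, (1 - t + t ^ 2)⁻¹ = 2 * Real.pi * √3 / 9 := by
  have hpi := Real.pi_pos
  have h := integral_inv_quadratic_cos (α := Real.pi / 3) (by linarith) (by linarith)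
  have h3 : √3 ^ 2 = 3 := Real.sq_sqrt (by norm_num)
  rw [Real.cos_pi_div_three, Real.sin_pi_div_three] at h
  have e : ∀ t : ℝ, t ^ 2 - 2 * (1 / 2) * t + 1 = 1 - t + t ^ 2 := fun t => by ring
  simp only [e] at h
  rw [h]
  field_simp
  linear_combination -6 * h3

/-- Let u = 6p and let Q be the sextic. From (1 + t³)² - Q = 4t³ sin²(3p), the integrand is -cot(3p)
times the difference of (1 + t)(1 + t³)/Q and 1/(1 - t + t²), both already integrated. The cotangent
forces u = 0 to be treated apart. -/
theorem integral_sextic_deriv {u : ℝ} (h0 : 0 ≤ u) (h1 : u < Real.pi) :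
    ∫ t in (0 : ℝ)..1, -(2 * t ^ 3 * Real.sin u) / (t ^ 6 + 2 * t ^ 3 * Real.cos u + 1)
        / (1 - t + t ^ 2)
      = -(4 * Real.pi * √3 / 9) * (Real.sin (u / 3) / (1 + 2 * Real.cos (u / 3))) := by
  rcases h0.eq_or_lt with rfl | h0
  · simp
  obtain ⟨p, rfl⟩ : ∃ p, u = 6 * p := ⟨u / 6, by ring⟩
  have hp : 0 < p := by linarith
  have hp1 : p < Real.pi / 6 := by linarith
  have hpi := Real.pi_pos
  have hs3 : 0 < Real.sin (3 * p) := Real.sin_pos_of_pos_of_lt_pi (by linarith) (by linarith)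
  have hc3 : 0 < Real.cos (3 * p) := Real.cos_pos_of_mem_Ioo ⟨by linarith, by linarith⟩
  have hc2 : 0 < Real.cos (2 * p) := Real.cos_pos_of_mem_Ioo ⟨by linarith, by linarith⟩
  have hsp : 0 < Real.sin p := Real.sin_pos_of_pos_of_lt_pi (by linarith) (by linarith)
  have e6s : Real.sin (6 * p) = 2 * Real.sin (3 * p) * Real.cos (3 * p) := by
    rw [← Real.sin_two_mul]; ring_nf
  have e6c : Real.cos (6 * p) = 1 - 2 * Real.sin (3 * p) ^ 2 := by
    rw [show 6 * p = 2 * (3 * p) by ring, Real.cos_two_mul, Real.cos_sq']; ring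
  have hcpos : -1 < Real.cos (6 * p) := by
    have := Real.cos_lt_cos_of_nonneg_of_le_pi (x := 6 * p) (y := Real.pi) (by linarith)
      le_rfl (by linarith)
    rwa [Real.cos_pi] at this
  have hQ : ∀ t : ℝ, 0 ≤ t → 0 < t ^ 6 + 2 * t ^ 3 * Real.cos (6 * p) + 1 := fun t ht =>
    lt_of_lt_of_le (by linarith) (add_one_div_two_le_sextic hcpos (Real.cos_le_one _) ht)
  have e : ∀ t ∈ uIcc (0 : ℝ) 1,
      -(2 * t ^ 3 * Real.sin (6 * p)) / (t ^ 6 + 2 * t ^ 3 * Real.cos (6 * p) + 1)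
        / (1 - t + t ^ 2)
      = -(Real.cos (3 * p) / Real.sin (3 * p)) *
        ((1 + t) * (1 + t ^ 3) / (t ^ 6 + 2 * t ^ 3 * Real.cos (6 * p) + 1)
          - (1 - t + t ^ 2)⁻¹) := by
    intro t ht
    rw [uIcc_of_le zero_le_one] at ht
    have hq := (hQ t ht.1).ne'
    have hr := (one_sub_add_sq_pos t).ne'
    rw [e6s]
    have : (1 + t) * (1 + t ^ 3) / (t ^ 6 + 2 * t ^ 3 * Real.cos (6 * p) + 1) - (1 - t + t ^ 2)⁻¹
      = 4 * t ^ 3 * Real.sin (3 * p) ^ 2 /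
        ((t ^ 6 + 2 * t ^ 3 * Real.cos (6 * p) + 1) * (1 - t + t ^ 2)) := by
      rw [← one_div, div_sub_div _ _ hq hr, e6c]
      congr 1
      ring
    rw [this]
    field_simp
    ring
  rw [intervalIntegral.integral_congr e, intervalIntegral.integral_const_mul,
    intervalIntegral.integral_sub, integral_cubic_kernel hp hp1, integral_inv_one_sub_add_sq,
    show 6 * p / 3 = 2 * p by ring]
  · have e3 : Real.sin (3 * p) = Real.sin p * (1 + 2 * Real.cos (2 * p)) := by
      rw [Real.sin_three_mul, Real.cos_two_mul, Real.cos_sq']; ring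
    have e4 : Real.cos p - Real.cos (3 * p) = 2 * Real.sin (2 * p) * Real.sin p := by
      rw [Real.cos_three_mul, Real.sin_two_mul]
      linear_combination -4 * Real.cos p * Real.sin_sq_add_cos_sq p
    have e5 : 2 * Real.pi * √3 / 9 * (Real.cos p / Real.cos (3 * p)) - 2 * Real.pi * √3 / 9
        = 2 * Real.pi * √3 / 9 * (2 * Real.sin (2 * p) * Real.sin p / Real.cos (3 * p)) := by
      rw [← e4]
      field_simp
    rw [e5, e3]
    field_simp
    ring
  · refine ContinuousOn.intervalIntegrable ?_
    rw [uIcc_of_le zero_le_one]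
    exact ContinuousOn.div (by fun_prop) (by fun_prop) (fun t ht => (hQ t ht.1).ne')
  · exact (Continuous.inv₀ (by fun_prop)
      (fun t => (one_sub_add_sq_pos t).ne')).intervalIntegrable _ _

theorem hasDerivAt_integral_log_sextic {u : ℝ} (h0 : 0 ≤ u) (h1 : u < Real.pi) :
    HasDerivAt (fun u => ∫ t in (0 : ℝ)..1,
        Real.log (t ^ 6 + 2 * t ^ 3 * Real.cos u + 1) / (1 - t + t ^ 2))
      (-(4 * Real.pi * √3 / 9) * (Real.sin (u / 3) / (1 + 2 * Real.cos (u / 3)))) u := by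
  rw [← integral_sextic_deriv h0 h1]
  -- On the symmetric interval (-b, b), a neighbourhood of u even for u = 0, cos v ≥ cos b > -1
  -- keeps the sextic away from 0.
  obtain ⟨b, hub, hb⟩ := exists_between h1
  have hcb : -1 < Real.cos b := by
    have := Real.cos_lt_cos_of_nonneg_of_le_pi (x := b) (y := Real.pi) (by linarith)
      le_rfl (by linarith)
    rwa [Real.cos_pi] at this
  have hQ : ∀ v ∈ Ioo (-b) b, ∀ t ∈ Icc (0 : ℝ) 1,
      (1 + Real.cos b) / 2 ≤ t ^ 6 + 2 * t ^ 3 * Real.cos v + 1 := by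
    intro v hv t ht
    have h3 : 0 ≤ t ^ 3 := by have := ht.1; positivity
    have hc : Real.cos b ≤ Real.cos v := by
      rw [← Real.cos_abs v]
      exact Real.cos_le_cos_of_nonneg_of_le_pi (abs_nonneg v) hb.le
        (abs_le.2 ⟨hv.1.le, hv.2.le⟩)
    have := add_one_div_two_le_sextic hcb (Real.cos_le_one _) ht.1
    nlinarith
  have hb2 : 0 < (1 + Real.cos b) / 2 := by linarith
  have hu : u ∈ Ioo (-b) b := ⟨by linarith, hub⟩
  have hcont : ∀ v ∈ Ioo (-b) b, ContinuousOn (fun t : ℝ =>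
      Real.log (t ^ 6 + 2 * t ^ 3 * Real.cos v + 1) / (1 - t + t ^ 2)) (Icc 0 1) := by
    intro v hv
    refine ContinuousOn.div (ContinuousOn.log (by fun_prop) fun t ht => ?_) (by fun_prop)
      (fun t _ => (one_sub_add_sq_pos t).ne')
    exact (hb2.trans_le (hQ v hv t ht)).ne'
  have hcont' : ContinuousOn (fun t : ℝ =>
      -(2 * t ^ 3 * Real.sin u) / (t ^ 6 + 2 * t ^ 3 * Real.cos u + 1) / (1 - t + t ^ 2))
      (Icc 0 1) := by
    refine ContinuousOn.div (ContinuousOn.div (by fun_prop) (by fun_prop) fun t ht => ?_)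
      (by fun_prop) (fun t _ => (one_sub_add_sq_pos t).ne')
    exact (hb2.trans_le (hQ u hu t ht)).ne'
  have hsub : uIoc (0 : ℝ) 1 ⊆ Icc 0 1 := by
    rw [uIoc_of_le zero_le_one]; exact Ioc_subset_Icc_self
  refine (intervalIntegral.hasDerivAt_integral_of_dominated_loc_of_deriv_le
    (F := fun v t => Real.log (t ^ 6 + 2 * t ^ 3 * Real.cos v + 1) / (1 - t + t ^ 2))
    (F' := fun v t => -(2 * t ^ 3 * Real.sin v) / (t ^ 6 + 2 * t ^ 3 * Real.cos v + 1)
      / (1 - t + t ^ 2))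
    (bound := fun _ => 2 / ((1 + Real.cos b) / 2) / (3 / 4)) (Ioo_mem_nhds hu.1 hu.2)
    ?_ ?_ ?_ ?_ intervalIntegrable_const ?_).2
  · filter_upwards [Ioo_mem_nhds hu.1 hu.2] with v hv
    exact ((hcont v hv).mono hsub).aestronglyMeasurable measurableSet_uIoc
  · refine ContinuousOn.intervalIntegrable ?_
    rw [uIcc_of_le zero_le_one]
    exact hcont u hu
  · exact (hcont'.mono hsub).aestronglyMeasurable measurableSet_uIoc
  · refine Eventually.of_forall fun t ht v hv => ?_
    have ht := hsub ht
    have hq := hQ v hv t ht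
    have hr : 3 / 4 ≤ 1 - t + t ^ 2 := by nlinarith [sq_nonneg (t - 1 / 2)]
    rw [norm_div, norm_div, Real.norm_of_nonneg (hb2.le.trans hq),
      Real.norm_of_nonneg (one_sub_add_sq_pos t).le]
    have hn : ‖-(2 * t ^ 3 * Real.sin v)‖ ≤ 2 := by
      have h3 : t ^ 3 ≤ 1 := pow_le_one₀ ht.1 ht.2
      have h3' : 0 ≤ t ^ 3 := pow_nonneg ht.1 3
      rw [norm_neg, norm_mul, norm_mul, Real.norm_of_nonneg h3', Real.norm_eq_abs (Real.sin v)]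
      have := Real.abs_sin_le_one v
      norm_num
      nlinarith [abs_nonneg (Real.sin v)]
    gcongr
  · refine Eventually.of_forall fun t ht v hv => ?_
    have hq := (hb2.trans_le (hQ v hv t (hsub ht))).ne'
    have h := ((((Real.hasDerivAt_cos v).const_mul (2 * t ^ 3)).const_add (t ^ 6)).add_const
      (1 : ℝ)).log hq |>.div_const (1 - t + t ^ 2)
    convert! h using 1
    ring

theorem integral_log_sextic {u : ℝ} (h0 : 0 ≤ u) (h1 : u < Real.pi) :
    ∫ t in (0 : ℝ)..1, Real.log (t ^ 6 + 2 * t ^ 3 * Real.cos u + 1) / (1 - t + t ^ 2)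
      = 2 * Real.pi * √3 / 3 * Real.log (1 + 2 * Real.cos (u / 3))
        + 3 * ∫ t in (0 : ℝ)..1, Real.log t / (1 - t + t ^ 2) := by
  have hd : ∀ v ∈ Icc 0 u, HasDerivAt (fun u => (∫ t in (0 : ℝ)..1,
        Real.log (t ^ 6 + 2 * t ^ 3 * Real.cos u + 1) / (1 - t + t ^ 2))
        - 2 * Real.pi * √3 / 3 * Real.log (1 + 2 * Real.cos (u / 3))) 0 v := by
    intro v hv
    have hc : 0 < Real.cos (v / 3) :=
      Real.cos_pos_of_mem_Ioo ⟨by linarith [hv.1, Real.pi_pos], by linarith [hv.2, Real.pi_pos]⟩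
    have h := hasDerivAt_integral_log_sextic hv.1 (hv.2.trans_lt h1)
    have h2 := ((((((hasDerivAt_id v).div_const 3).cos).const_mul 2).const_add 1).log
      (by simp only [id]; positivity)).const_mul (2 * Real.pi * √3 / 3)
    convert! h.sub h2 using 1
    simp only [id]
    field_simp
    ring
  have hconst := constant_of_has_deriv_right_zero (a := 0) (b := u)
    (fun v hv => (hd v hv).continuousAt.continuousWithinAt)
    (fun v hv => (hd v (Ico_subset_Icc_self hv)).hasDerivWithinAt) u ⟨h0, le_rfl⟩
  have hbase : ∫ t in (0 : ℝ)..1, Real.log (t ^ 6 + 2 * t ^ 3 * Real.cos 0 + 1) / (1 - t + t ^ 2)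
      = 2 * ∫ t in (0 : ℝ)..1, Real.log (1 + t ^ 3) / (1 - t + t ^ 2) := by
    rw [← intervalIntegral.integral_const_mul]
    refine intervalIntegral.integral_congr fun t _ => ?_
    rw [Real.cos_zero, show t ^ 6 + 2 * t ^ 3 * 1 + 1 = (1 + t ^ 3) ^ 2 by ring, Real.log_pow]
    push_cast
    ring
  beta_reduce at hconst
  rw [hbase, integral_log_one_add_cube_eq, zero_div, Real.cos_zero,
    show (1 : ℝ) + 2 * 1 = 3 by norm_num] at hconst
  have h3 : Real.pi / √3 = Real.pi * √3 / 3 := by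
    have h3 : √3 ^ 2 = 3 := Real.sq_sqrt (by norm_num)
    field_simp
    linear_combination -h3
  rw [h3] at hconst
  linarith

/-! ### Real factorization of 1 + s^m and the integral of log(1 + t^(3m)) -/

/-- Factorization of `1 + s ^ m` for odd `m` over the reals. -/
theorem one_add_pow_eq_prod {m : ℕ} (hm : Odd m) (s : ℝ) :
    1 + s ^ m = (1 + s) * ∏ k ∈ Finset.range ((m - 1) / 2),
      (s ^ 2 - 2 * s * phi m k + 1) := by
  obtain ⟨r, rfl⟩ := hm
  have hr : (2 * r + 1 - 1) / 2 = r := by omega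
  rw [hr]
  have hm0 : 2 * r + 1 ≠ 0 := by omega
  have hmC : ((2 * r + 1 : ℕ) : ℂ) ≠ 0 := by exact_mod_cast hm0
  set ζ := Complex.exp (2 * Real.pi * Complex.I / (2 * r + 1 : ℕ)) with hζ
  have hprim : IsPrimitiveRoot ζ (2 * r + 1) := Complex.isPrimitiveRoot_exp _ hm0
  have h1 := hprim.pow_add_pow_eq_prod_add_mul (x := (1 : ℂ)) (y := (s : ℂ)) ⟨r, rfl⟩
  have h2 : ∏ μ ∈ Polynomial.nthRootsFinset (2 * r + 1) (1 : ℂ), (1 + μ * (s : ℂ))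
      = ∏ j ∈ Finset.range (2 * r + 1), (1 + ζ ^ j * (s : ℂ)) := by
    symm
    refine Finset.prod_bij (fun j _ => ζ ^ j) ?_ ?_ ?_ (fun _ _ => rfl)
    · intro j _
      rw [Polynomial.mem_nthRootsFinset (by omega), ← pow_mul, mul_comm, pow_mul,
        hprim.pow_eq_one, one_pow]
    · intro i hi j hj h
      exact hprim.pow_inj (Finset.mem_range.1 hi) (Finset.mem_range.1 hj) h
    · intro μ hμ
      rw [Polynomial.mem_nthRootsFinset (by omega)] at hμ
      obtain ⟨i, hi, h⟩ := hprim.eq_pow_of_pow_eq_one hμ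
      exact ⟨i, Finset.mem_range.2 hi, h⟩
  -- Apart from the root 1, the conjugate roots ζ^(r-k) and ζ^(r+k+1) are paired; they equal
  -- -exp(∓iθ) with θ = (2k+1)π/m.
  rw [h2, Finset.prod_range_succ', two_mul, Finset.prod_range_add, pow_zero, one_mul,
    ← Finset.prod_range_reflect, ← Finset.prod_mul_distrib, one_pow, ← two_mul] at h1
  have h3 : ∀ k ∈ Finset.range r, (1 + ζ ^ (r - 1 - k + 1) * (s : ℂ)) * (1 + ζ ^ (r + k + 1) * s)
      = ((s ^ 2 - 2 * s * phi (2 * r + 1) k + 1 : ℝ) : ℂ) := by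
    intro k hk
    have hk := Finset.mem_range.1 hk
    set θ : ℝ := (2 * (k : ℝ) + 1) * Real.pi / ((2 * r + 1 : ℕ) : ℝ) with hθ
    have hθC : (θ : ℂ) = (2 * (k : ℂ) + 1) * Real.pi / ((2 * r + 1 : ℕ) : ℂ) := by
      rw [hθ]; push_cast; ring
    have ea : ζ ^ (r + k + 1) = -Complex.exp (θ * Complex.I) := by
      rw [hζ, ← Complex.exp_nat_mul, ← Complex.exp_add_pi_mul_I, hθC]
      congr 1
      field_simp
      push_cast
      ring
    have eb : ζ ^ (r - 1 - k + 1) = -Complex.exp (-(θ * Complex.I)) := by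
      obtain ⟨d, rfl⟩ : ∃ d, r = k + 1 + d := ⟨r - (k + 1), by omega⟩
      rw [show k + 1 + d - 1 - k + 1 = d + 1 by omega, hζ, ← Complex.exp_nat_mul,
        ← Complex.exp_add_pi_mul_I, hθC]
      congr 1
      field_simp
      push_cast
      ring
    have ec : Complex.exp (θ * Complex.I) * Complex.exp (-(θ * Complex.I)) = 1 := by
      rw [← Complex.exp_add, add_neg_cancel, Complex.exp_zero]
    have ed : 2 * Complex.cos θ = Complex.exp (θ * Complex.I) + Complex.exp (-(θ * Complex.I)) := by
      rw [Complex.two_cos, neg_mul]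
    rw [ea, eb, phi, ← hθ]
    push_cast
    linear_combination (s : ℂ) ^ 2 * ec + (s : ℂ) * ed
  rw [Finset.prod_congr rfl h3] at h1
  apply Complex.ofReal_injective
  push_cast at h1 ⊢
  rw [h1]
  ring

theorem mem_Ioo_of_lt_half {m k : ℕ} (hk : k < (m - 1) / 2) :
    Real.pi - (2 * (k : ℝ) + 1) * Real.pi / m ∈ Ioo 0 Real.pi := by
  have hm : 2 * k + 1 < m := by omega
  have hm' : 2 * (k : ℝ) + 1 < m := by exact_mod_cast hm
  have hmp : (0 : ℝ) < m := by linarith [(Nat.cast_nonneg k : (0 : ℝ) ≤ k)]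
  have hpi := Real.pi_pos
  constructor
  · rw [sub_pos, div_lt_iff₀ hmp]
    nlinarith
  · have : 0 < (2 * (k : ℝ) + 1) * Real.pi / m := by positivity
    linarith

theorem intervalIntegrable_div_one_sub_add_sq {f : ℝ → ℝ} (hf : ContinuousOn f (Icc 0 1)) :
    IntervalIntegrable (fun t => f t / (1 - t + t ^ 2)) MeasureTheory.volume 0 1 := by
  refine ContinuousOn.intervalIntegrable ?_
  rw [uIcc_of_le zero_le_one]
  exact hf.div (by fun_prop) fun t _ => (one_sub_add_sq_pos t).ne'

theorem integral_log_one_add_pow {m : ℕ} (hm : Odd m) :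
    ∫ t in (0 : ℝ)..1, Real.log (1 + t ^ (3 * m)) / (1 - t + t ^ 2)
      = Real.pi * √3 / 3 * Real.log 3
        + 2 * Real.pi * √3 / 3 * ∑ k ∈ Finset.range ((m - 1) / 2),
          Real.log (1 + 2 * Real.cos ((Real.pi - (2 * (k : ℝ) + 1) * Real.pi / m) / 3))
        + 3 * m / 2 * ∫ t in (0 : ℝ)..1, Real.log t / (1 - t + t ^ 2) := by
  set u : ℕ → ℝ := fun k => Real.pi - (2 * (k : ℝ) + 1) * Real.pi / m with hu
  have hQ : ∀ k ∈ Finset.range ((m - 1) / 2), ∀ t ∈ Icc (0 : ℝ) 1,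
      0 < t ^ 6 + 2 * t ^ 3 * Real.cos (u k) + 1 := by
    intro k hk t ht
    have hk' := mem_Ioo_of_lt_half (Finset.mem_range.1 hk)
    have := Real.cos_lt_cos_of_nonneg_of_le_pi hk'.1.le le_rfl hk'.2
    rw [Real.cos_pi] at this
    exact lt_of_lt_of_le (by linarith) (add_one_div_two_le_sextic this (Real.cos_le_one _) ht.1)
  have e : ∀ t ∈ uIcc (0 : ℝ) 1, Real.log (1 + t ^ (3 * m)) / (1 - t + t ^ 2)
      = Real.log (1 + t ^ 3) / (1 - t + t ^ 2) + ∑ k ∈ Finset.range ((m - 1) / 2),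
        Real.log (t ^ 6 + 2 * t ^ 3 * Real.cos (u k) + 1) / (1 - t + t ^ 2) := by
    intro t ht
    rw [uIcc_of_le zero_le_one] at ht
    have h3 : 0 ≤ t ^ 3 := pow_nonneg ht.1 3
    have hfac : ∀ k ∈ Finset.range ((m - 1) / 2), (t ^ 3) ^ 2 - 2 * t ^ 3 * phi m k + 1
        = t ^ 6 + 2 * t ^ 3 * Real.cos (u k) + 1 := by
      intro k _
      rw [hu, phi, Real.cos_pi_sub]
      ring
    rw [pow_mul, one_add_pow_eq_prod hm, Finset.prod_congr rfl hfac,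
      Real.log_mul (by positivity) (Finset.prod_pos fun k hk => hQ k hk t ht).ne',
      Real.log_prod fun k hk => (hQ k hk t ht).ne', add_div, Finset.sum_div]
  have hi0 : IntervalIntegrable (fun t : ℝ => Real.log (1 + t ^ 3) / (1 - t + t ^ 2))
      MeasureTheory.volume 0 1 :=
    intervalIntegrable_div_one_sub_add_sq (ContinuousOn.log (by fun_prop) fun t ht => by
      have := pow_nonneg ht.1 3
      positivity)
  have hi : ∀ k ∈ Finset.range ((m - 1) / 2), IntervalIntegrable (fun t : ℝ =>
      Real.log (t ^ 6 + 2 * t ^ 3 * Real.cos (u k) + 1) / (1 - t + t ^ 2))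
      MeasureTheory.volume 0 1 := fun k hk =>
    intervalIntegrable_div_one_sub_add_sq (ContinuousOn.log (by fun_prop) fun t ht => (hQ k hk t ht).ne')
  have hsum : IntervalIntegrable (fun t : ℝ => ∑ k ∈ Finset.range ((m - 1) / 2),
      Real.log (t ^ 6 + 2 * t ^ 3 * Real.cos (u k) + 1) / (1 - t + t ^ 2))
      MeasureTheory.volume 0 1 := by
    convert! IntervalIntegrable.sum (Finset.range ((m - 1) / 2)) hi using 1
    ext t
    rw [Finset.sum_apply]
  have hS : ∀ k ∈ Finset.range ((m - 1) / 2), ∫ t in (0 : ℝ)..1,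
        Real.log (t ^ 6 + 2 * t ^ 3 * Real.cos (u k) + 1) / (1 - t + t ^ 2)
      = 2 * Real.pi * √3 / 3 * Real.log (1 + 2 * Real.cos (u k / 3))
        + 3 * ∫ t in (0 : ℝ)..1, Real.log t / (1 - t + t ^ 2) := fun k hk =>
    integral_log_sextic (mem_Ioo_of_lt_half (Finset.mem_range.1 hk)).1.le
      (mem_Ioo_of_lt_half (Finset.mem_range.1 hk)).2
  have h3 : Real.pi / √3 = Real.pi * √3 / 3 := by
    have h3 : √3 ^ 2 = 3 := Real.sq_sqrt (by norm_num)
    field_simp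
    linear_combination -h3
  rw [intervalIntegral.integral_congr e, intervalIntegral.integral_add hi0 hsum,
    intervalIntegral.integral_finsetSum hi, Finset.sum_congr rfl hS, Finset.sum_add_distrib,
    ← Finset.mul_sum, Finset.sum_const, Finset.card_range, integral_log_one_add_cube_eq, h3,
    nsmul_eq_mul]
  have hmr : (m : ℝ) = 2 * (((m - 1) / 2 : ℕ) : ℝ) + 1 := by
    obtain ⟨r, rfl⟩ := hm
    rw [show (2 * r + 1 - 1) / 2 = r by omega]
    push_cast
    ring
  change _ = Real.pi * √3 / 3 * Real.log 3 + 2 * Real.pi * √3 / 3 *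
    ∑ k ∈ Finset.range ((m - 1) / 2), Real.log (1 + 2 * Real.cos (u k / 3)) + _
  -- The factor 1 + t³ contributes 3/2 of L and each of the (m-1)/2 sextics contributes 3, in total
  -- 3m/2.
  linear_combination -(3 / 2 * ∫ t in (0 : ℝ)..1, Real.log t / (1 - t + t ^ 2)) * hmr

/-! ### Evaluation of the integral of log t / (1 - t + t²) -/

theorem hasSum_neg_one_pow_div_three_mul_add_two :
    HasSum (fun n : ℕ => (-1 : ℝ) ^ n / (3 * (n : ℝ) + 2) ^ 2)
      ((psiDeriv (1 / 3) - psiDeriv (5 / 6)) / 36) := by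
  have h1 := hasSum_psiDeriv (x := 1 / 3) (by norm_num) (by norm_num)
  have h2 := hasSum_psiDeriv (x := 5 / 6) (by norm_num) (by norm_num)
  have he : HasSum (fun n : ℕ => (-1 : ℝ) ^ (2 * n) / (3 * ((2 * n : ℕ) : ℝ) + 2) ^ 2)
      (1 / 36 * psiDeriv (1 / 3)) := by
    refine (h1.mul_left (1 / 36)).congr_fun fun n => ?_
    rw [pow_mul, neg_one_sq, one_pow]
    push_cast
    rw [show 3 * (2 * (n : ℝ)) + 2 = 6 * (n + 1 / 3) by ring, mul_pow, one_div, mul_inv]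
    norm_num
  have ho : HasSum (fun n : ℕ => (-1 : ℝ) ^ (2 * n + 1) / (3 * ((2 * n + 1 : ℕ) : ℝ) + 2) ^ 2)
      (-1 / 36 * psiDeriv (5 / 6)) := by
    refine (h2.mul_left (-1 / 36)).congr_fun fun n => ?_
    rw [pow_succ, pow_mul, neg_one_sq, one_pow]
    push_cast
    rw [show 3 * (2 * (n : ℝ) + 1) + 2 = 6 * (n + 5 / 6) by ring, mul_pow, div_eq_mul_inv, mul_inv]
    norm_num
  have h := HasSum.even_add_odd (f := fun n : ℕ => (-1 : ℝ) ^ n / (3 * (n : ℝ) + 2) ^ 2) he ho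
  rwa [show 1 / 36 * psiDeriv (1 / 3) + -1 / 36 * psiDeriv (5 / 6)
    = (psiDeriv (1 / 3) - psiDeriv (5 / 6)) / 36 by ring] at h

theorem bernoulli_two_eval (x : ℝ) :
    (Polynomial.map (algebraMap ℚ ℝ) (Polynomial.bernoulli 2)).eval x = x ^ 2 - x + 1 / 6 := by
  simp [Polynomial.bernoulli, Finset.sum_range_succ, bernoulli_eq_bernoulli'_of_ne_one]
  ring

theorem hasSum_cos_div_sq {x : ℝ} (hx : x ∈ Icc (0 : ℝ) 1) :
    HasSum (fun n : ℕ => 1 / (n : ℝ) ^ 2 * Real.cos (2 * Real.pi * n * x))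
      (Real.pi ^ 2 * (x ^ 2 - x + 1 / 6)) := by
  have h := hasSum_one_div_nat_pow_mul_cos one_ne_zero hx
  rw [mul_one, bernoulli_two_eval] at h
  have e : (-1 : ℝ) ^ (1 + 1) * (2 * Real.pi) ^ 2 / 2 / ((Nat.factorial 2 : ℕ) : ℝ)
      = Real.pi ^ 2 := by
    rw [Nat.factorial_two]
    push_cast
    ring
  rwa [e] at h

/-- The coefficient (2/3)(cos(πn/3) - cos(πn)) is 0, (-1)^N, -(-1)^N for n = 3N, 3N+1, 3N+2, so the
sum comes from the Fourier series of the second Bernoulli polynomial at 1/6 and 1/2. -/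
theorem tendsto_sum_alternating_inv_sq_sub :
    Tendsto (fun N : ℕ => ∑ n ∈ Finset.range N,
      ((-1 : ℝ) ^ n / (3 * (n : ℝ) + 1) ^ 2 - (-1 : ℝ) ^ n / (3 * (n : ℝ) + 2) ^ 2))
      atTop (𝓝 (2 * Real.pi ^ 2 / 27)) := by
  have h1 := hasSum_cos_div_sq (x := 1 / 6) ⟨by norm_num, by norm_num⟩
  have h2 := hasSum_cos_div_sq (x := 1 / 2) ⟨by norm_num, by norm_num⟩
  have h := (((h1.sub h2).mul_left (2 / 3)).tendsto_sum_nat).comp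
    (tendsto_id.const_mul_atTop' (by norm_num : 0 < 3))
  have hv : 2 / 3 * (Real.pi ^ 2 * ((1 / 6) ^ 2 - 1 / 6 + 1 / 6)
      - Real.pi ^ 2 * ((1 / 2) ^ 2 - 1 / 2 + 1 / 6)) = 2 * Real.pi ^ 2 / 27 := by ring
  rw [hv] at h
  refine h.congr fun N => ?_
  simp only [Function.comp_apply, id]
  induction N with
  | zero => simp
  | succ N ih =>
    rw [Finset.sum_range_succ, ← ih, show 3 * (N + 1) = 3 * N + 1 + 1 + 1 by ring,
      Finset.sum_range_succ, Finset.sum_range_succ, Finset.sum_range_succ]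
    have hp : (-1 : ℝ) ^ (3 * N) = (-1) ^ N := by
      rw [pow_mul]; norm_num
    have c0 : Real.cos (2 * Real.pi * ((3 * N : ℕ) : ℝ) * (1 / 6)) = (-1) ^ N := by
      rw [show 2 * Real.pi * ((3 * N : ℕ) : ℝ) * (1 / 6) = 0 + N * Real.pi by push_cast; ring,
        Real.cos_add_nat_mul_pi, Real.cos_zero, mul_one]
    have d0 : Real.cos (2 * Real.pi * ((3 * N : ℕ) : ℝ) * (1 / 2)) = (-1) ^ N := by
      rw [show 2 * Real.pi * ((3 * N : ℕ) : ℝ) * (1 / 2) = 0 + (3 * N : ℕ) * Real.pi by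
        push_cast; ring, Real.cos_add_nat_mul_pi, Real.cos_zero, mul_one, hp]
    have c1 : Real.cos (2 * Real.pi * ((3 * N + 1 : ℕ) : ℝ) * (1 / 6)) = (-1) ^ N * (1 / 2) := by
      rw [show 2 * Real.pi * ((3 * N + 1 : ℕ) : ℝ) * (1 / 6) = Real.pi / 3 + N * Real.pi by
        push_cast; ring, Real.cos_add_nat_mul_pi, Real.cos_pi_div_three]
    have d1 : Real.cos (2 * Real.pi * ((3 * N + 1 : ℕ) : ℝ) * (1 / 2)) = -(-1) ^ N := by
      rw [show 2 * Real.pi * ((3 * N + 1 : ℕ) : ℝ) * (1 / 2) = Real.pi + (3 * N : ℕ) * Real.pi by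
        push_cast; ring, Real.cos_add_nat_mul_pi, Real.cos_pi, hp, mul_neg_one]
    have c2 : Real.cos (2 * Real.pi * ((3 * N + 1 + 1 : ℕ) : ℝ) * (1 / 6))
        = -((-1) ^ N * (1 / 2)) := by
      rw [show 2 * Real.pi * ((3 * N + 1 + 1 : ℕ) : ℝ) * (1 / 6)
        = (Real.pi - Real.pi / 3) + N * Real.pi by push_cast; ring, Real.cos_add_nat_mul_pi,
        Real.cos_pi_sub, Real.cos_pi_div_three, mul_neg]
    have d2 : Real.cos (2 * Real.pi * ((3 * N + 1 + 1 : ℕ) : ℝ) * (1 / 2)) = (-1) ^ N := by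
      rw [show 2 * Real.pi * ((3 * N + 1 + 1 : ℕ) : ℝ) * (1 / 2)
        = 2 * Real.pi + (3 * N : ℕ) * Real.pi by push_cast; ring, Real.cos_add_nat_mul_pi,
        Real.cos_two_pi, hp, mul_one]
    rw [c0, c1, c2, d0, d1, d2]
    push_cast
    ring

theorem intervalIntegrable_pow_mul_log (k : ℕ) :
    IntervalIntegrable (fun t : ℝ => t ^ k * Real.log t) MeasureTheory.volume 0 1 :=
  intervalIntegral.intervalIntegrable_log'.continuousOn_mul (by fun_prop)

theorem integral_pow_mul_log (k : ℕ) :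
    ∫ t in (0 : ℝ)..1, t ^ k * Real.log t = -1 / ((k : ℝ) + 1) ^ 2 := by
  have hk : (k : ℝ) + 1 ≠ 0 := by positivity
  have hcont : Continuous fun t : ℝ =>
      t ^ (k + 1) * Real.log t / (k + 1) - t ^ (k + 1) / ((k : ℝ) + 1) ^ 2 := by
    have e : ∀ t : ℝ, t ^ (k + 1) * Real.log t = t ^ k * (t * Real.log t) := fun t => by ring
    simp only [e]
    have := Real.continuous_mul_log
    fun_prop
  rw [intervalIntegral.integral_eq_sub_of_hasDerivAt_of_le zero_le_one hcont.continuousOn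
    (f' := fun t => t ^ k * Real.log t) ?_ (intervalIntegrable_pow_mul_log k)]
  · simp
    ring
  · intro t ht
    have ht0 := ht.1.ne'
    convert! (((hasDerivAt_pow (k + 1) t).mul (Real.hasDerivAt_log ht0)).div_const
      ((k : ℝ) + 1)).sub ((hasDerivAt_pow (k + 1) t).div_const (((k : ℝ) + 1) ^ 2)) using 1
    push_cast
    field_simp
    ring

theorem inv_one_sub_add_sq_eq_sum_add (N : ℕ) (t : ℝ) :
    (1 - t + t ^ 2)⁻¹ = ∑ n ∈ Finset.range N, (-1) ^ n * (t ^ (3 * n) + t ^ (3 * n + 1))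
      + (-1) ^ N * (t ^ (3 * N) / (1 - t + t ^ 2)) := by
  have h := (one_sub_add_sq_pos t).ne'
  induction N with
  | zero => simp
  | succ N ih =>
    rw [ih, Finset.sum_range_succ]
    field_simp
    ring

theorem tendsto_sum_alternating_inv_sq_add :
    Tendsto (fun N : ℕ => ∑ n ∈ Finset.range N,
      ((-1 : ℝ) ^ n / (3 * (n : ℝ) + 1) ^ 2 + (-1 : ℝ) ^ n / (3 * (n : ℝ) + 2) ^ 2))
      atTop (𝓝 (-∫ t in (0 : ℝ)..1, Real.log t / (1 - t + t ^ 2))) := by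
  have hR : ∀ N : ℕ, IntervalIntegrable (fun t : ℝ => t ^ (3 * N) / (1 - t + t ^ 2) * Real.log t)
      MeasureTheory.volume 0 1 := fun N =>
    intervalIntegral.intervalIntegrable_log'.continuousOn_mul
      (ContinuousOn.div (by fun_prop) (by fun_prop) fun t _ => (one_sub_add_sq_pos t).ne')
  have hterm : ∀ n : ℕ, IntervalIntegrable (fun t : ℝ =>
      (-1) ^ n * (t ^ (3 * n) * Real.log t + t ^ (3 * n + 1) * Real.log t))
      MeasureTheory.volume 0 1 := fun n =>
    ((intervalIntegrable_pow_mul_log _).add (intervalIntegrable_pow_mul_log _)).const_mul _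
  have hS : ∀ N : ℕ, ∑ n ∈ Finset.range N,
      ((-1 : ℝ) ^ n / (3 * (n : ℝ) + 1) ^ 2 + (-1 : ℝ) ^ n / (3 * (n : ℝ) + 2) ^ 2)
      = -(∫ t in (0 : ℝ)..1, Real.log t / (1 - t + t ^ 2))
        + (-1) ^ N * ∫ t in (0 : ℝ)..1, t ^ (3 * N) / (1 - t + t ^ 2) * Real.log t := by
    intro N
    have e : ∀ t : ℝ, Real.log t / (1 - t + t ^ 2)
        = ∑ n ∈ Finset.range N, (-1) ^ n * (t ^ (3 * n) * Real.log t + t ^ (3 * n + 1) * Real.log t)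
          + (-1) ^ N * (t ^ (3 * N) / (1 - t + t ^ 2) * Real.log t) := by
      intro t
      rw [div_eq_mul_inv, inv_one_sub_add_sq_eq_sum_add N t, mul_add, Finset.mul_sum]
      congr 1
      · exact Finset.sum_congr rfl fun n _ => by ring
      · ring
    have hsum : IntervalIntegrable (fun t : ℝ => ∑ n ∈ Finset.range N,
        (-1) ^ n * (t ^ (3 * n) * Real.log t + t ^ (3 * n + 1) * Real.log t))
        MeasureTheory.volume 0 1 := by
      convert! IntervalIntegrable.sum (Finset.range N) (fun n _ => hterm n) using 1
      ext t
      rw [Finset.sum_apply]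
    have hint : ∫ t in (0 : ℝ)..1, Real.log t / (1 - t + t ^ 2)
        = (∑ n ∈ Finset.range N, ∫ t in (0 : ℝ)..1,
            (-1) ^ n * (t ^ (3 * n) * Real.log t + t ^ (3 * n + 1) * Real.log t))
          + (-1) ^ N * ∫ t in (0 : ℝ)..1, t ^ (3 * N) / (1 - t + t ^ 2) * Real.log t := by
      rw [intervalIntegral.integral_congr fun t _ => e t,
        intervalIntegral.integral_add hsum ((hR N).const_mul _),
        intervalIntegral.integral_finsetSum fun n _ => hterm n,
        intervalIntegral.integral_const_mul]
    rw [hint, neg_add, neg_add_cancel_right, ← Finset.sum_neg_distrib]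
    refine Finset.sum_congr rfl fun n _ => ?_
    rw [intervalIntegral.integral_const_mul, intervalIntegral.integral_add
      (intervalIntegrable_pow_mul_log _) (intervalIntegrable_pow_mul_log _),
      integral_pow_mul_log, integral_pow_mul_log]
    push_cast
    rw [show 3 * (n : ℝ) + 1 + 1 = 3 * n + 2 by ring]
    ring
  have hbound : ∀ N : ℕ, ‖(-1 : ℝ) ^ N * ∫ t in (0 : ℝ)..1,
      t ^ (3 * N) / (1 - t + t ^ 2) * Real.log t‖ ≤ 4 / 3 * (1 / ((N : ℝ) + 1)) := by
    intro N
    rw [norm_mul, norm_pow, norm_neg, norm_one, one_pow, one_mul]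
    have h := intervalIntegral.norm_integral_le_of_norm_le (μ := MeasureTheory.volume)
      (f := fun t : ℝ => t ^ (3 * N) / (1 - t + t ^ 2) * Real.log t)
      (g := fun t : ℝ => -(4 / 3) * (t ^ (3 * N) * Real.log t)) zero_le_one
      (Eventually.of_forall fun t ht => ?_) ((intervalIntegrable_pow_mul_log _).const_mul _)
    · rw [intervalIntegral.integral_const_mul, integral_pow_mul_log] at h
      refine h.trans ?_
      push_cast
      rw [neg_mul, neg_div, mul_neg, neg_neg]
      gcongr
      nlinarith [(Nat.cast_nonneg N : (0 : ℝ) ≤ N)]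
    · have hp : 0 ≤ t ^ (3 * N) := pow_nonneg ht.1.le _
      have hl : Real.log t ≤ 0 := Real.log_nonpos ht.1.le ht.2
      have hr : 3 / 4 ≤ 1 - t + t ^ 2 := by nlinarith [sq_nonneg (t - 1 / 2)]
      have hr' := one_sub_add_sq_pos t
      rw [norm_mul, norm_div, Real.norm_of_nonneg hp, Real.norm_of_nonneg hr'.le,
        Real.norm_of_nonpos hl]
      have : t ^ (3 * N) / (1 - t + t ^ 2) ≤ t ^ (3 * N) / (3 / 4) := by gcongr
      nlinarith
  have hlim := squeeze_zero_norm hbound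
    (by simpa using (tendsto_one_div_add_atTop_nhds_zero_nat (𝕜 := ℝ)).const_mul (4 / 3))
  simp only [hS]
  simpa using hlim.const_add (-∫ t in (0 : ℝ)..1, Real.log t / (1 - t + t ^ 2))

/-- The sum with a plus sign is the sum with a minus sign plus twice the series over (3n + 2)²,
which ψ' evaluates. -/
theorem integral_log_div_eq_psiDeriv :
    ∫ t in (0 : ℝ)..1, Real.log t / (1 - t + t ^ 2)
      = (psiDeriv (5 / 6) - psiDeriv (1 / 3)) / 18 - 2 * Real.pi ^ 2 / 27 := by
  have h := tendsto_sum_alternating_inv_sq_sub.add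
    (hasSum_neg_one_pow_div_three_mul_add_two.tendsto_sum_nat.const_mul 2)
  have h' := tendsto_nhds_unique tendsto_sum_alternating_inv_sq_add (h.congr fun N => by
    rw [Finset.mul_sum, ← Finset.sum_add_distrib]
    exact Finset.sum_congr rfl fun n _ => by ring)
  linarith

/-! ### Kernel moments, summation by parts and passage to the limit -/

/-- The error has derivative (-1)^N y^N/(1 + y), of size at most y^N. The resulting bound is uniform
up to x = 1, so limit and integral can be exchanged. -/
theorem abs_log_one_add_sub_sum_le (N : ℕ) {x : ℝ} (h0 : 0 ≤ x) (h1 : x ≤ 1) :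
    |Real.log (1 + x) - ∑ n ∈ Finset.range N, (-1) ^ n / ((n : ℝ) + 1) * x ^ (n + 1)|
      ≤ 1 / ((N : ℝ) + 1) := by
  have hd : ∀ y ∈ Icc (0 : ℝ) 1, HasDerivAt (fun x : ℝ =>
      Real.log (1 + x) - ∑ n ∈ Finset.range N, (-1) ^ n / ((n : ℝ) + 1) * x ^ (n + 1))
      ((-1) ^ N * y ^ N / (1 + y)) y := by
    intro y hy
    have hy' : 1 + y ≠ 0 := by linarith [hy.1]
    have hs : HasDerivAt (fun x : ℝ => ∑ n ∈ Finset.range N, (-1) ^ n / ((n : ℝ) + 1) * x ^ (n + 1))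
        (∑ n ∈ Finset.range N, (-y) ^ n) y := by
      refine HasDerivAt.fun_sum fun n _ => ?_
      convert! (hasDerivAt_pow (n + 1) y).const_mul ((-1) ^ n / ((n : ℝ) + 1)) using 1
      have : (n : ℝ) + 1 ≠ 0 := by positivity
      rw [neg_pow]
      push_cast
      field_simp
    convert! (((hasDerivAt_id y).const_add 1).log hy').sub hs using 1
    rw [geom_sum_eq (by linarith [hy.1]), neg_pow y N]
    have : -y - 1 ≠ 0 := by linarith [hy.1]
    simp only [id]
    field_simp
    ring
  have hN : (N : ℝ) + 1 ≠ 0 := by positivity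
  have key := image_norm_le_of_norm_deriv_right_le_deriv_boundary (a := 0) (b := 1)
    (f := fun x : ℝ =>
      Real.log (1 + x) - ∑ n ∈ Finset.range N, (-1) ^ n / ((n : ℝ) + 1) * x ^ (n + 1))
    (B := fun x => x ^ (N + 1) / ((N : ℝ) + 1)) (B' := fun x => x ^ N)
    (fun y hy => (hd y hy).continuousAt.continuousWithinAt)
    (fun y hy => (hd y (Ico_subset_Icc_self hy)).hasDerivWithinAt)
    (by simp)
    (fun y => by
      convert! (hasDerivAt_pow (N + 1) y).div_const ((N : ℝ) + 1) using 1
      push_cast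
      field_simp)
    (fun y hy => by
      have hyN := pow_nonneg hy.1 N
      rw [norm_div, norm_mul, norm_pow, norm_neg, norm_one, one_pow, one_mul,
        Real.norm_of_nonneg hyN, Real.norm_of_nonneg (by linarith [hy.1])]
      exact div_le_self hyN (by linarith [hy.1]))
    (x := x) ⟨h0, h1⟩
  refine key.trans ?_
  have := pow_le_one₀ h0 h1 (n := N + 1)
  gcongr

/-- The moments `∫₀¹ t ^ j / (1 - t + t ^ 2)`. -/
noncomputable def kernelMoment (j : ℕ) : ℝ := ∫ t in (0 : ℝ)..1, t ^ j / (1 - t + t ^ 2)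

theorem intervalIntegrable_pow_div (j : ℕ) :
    IntervalIntegrable (fun t : ℝ => t ^ j / (1 - t + t ^ 2)) MeasureTheory.volume 0 1 :=
  intervalIntegrable_div_one_sub_add_sq (by fun_prop)

theorem kernelMoment_add (m j : ℕ) (hm : Odd m) :
    kernelMoment j + kernelMoment (j + 3 * m)
      = ∑ p ∈ Finset.range m, ((-1) ^ p / ((j : ℝ) + 3 * (p : ℝ) + 1)
        + (-1) ^ p / ((j : ℝ) + 3 * (p : ℝ) + 2)) := by
  have e : ∀ t : ℝ, t ^ j / (1 - t + t ^ 2) + t ^ (j + 3 * m) / (1 - t + t ^ 2)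
      = ∑ p ∈ Finset.range m, (-1) ^ p * (t ^ (j + 3 * p) + t ^ (j + 3 * p + 1)) := by
    intro t
    have h := inv_one_sub_add_sq_eq_sum_add m t
    -- Oddness of m makes the remainder of the geometric sum negative, so it joins the left side as
    -- a second moment with a plus sign.
    rw [hm.neg_one_pow] at h
    have h2 : ∑ p ∈ Finset.range m, (-1) ^ p * (t ^ (j + 3 * p) + t ^ (j + 3 * p + 1))
        = t ^ j * ∑ p ∈ Finset.range m, (-1) ^ p * (t ^ (3 * p) + t ^ (3 * p + 1)) := by
      rw [Finset.mul_sum]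
      exact Finset.sum_congr rfl fun p _ => by ring
    rw [h2, pow_add]
    linear_combination t ^ j * h
  have hi : ∀ p : ℕ, IntervalIntegrable
      (fun t : ℝ => (-1 : ℝ) ^ p * (t ^ (j + 3 * p) + t ^ (j + 3 * p + 1)))
      MeasureTheory.volume 0 1 := fun p => (by fun_prop : Continuous _).intervalIntegrable _ _
  rw [kernelMoment, kernelMoment, ← intervalIntegral.integral_add (intervalIntegrable_pow_div _)
    (intervalIntegrable_pow_div _), intervalIntegral.integral_congr fun t _ => e t,
    intervalIntegral.integral_finsetSum fun p _ => hi p]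
  refine Finset.sum_congr rfl fun p _ => ?_
  rw [intervalIntegral.integral_const_mul, intervalIntegral.integral_add
    ((by fun_prop : Continuous _).intervalIntegrable _ _)
    ((by fun_prop : Continuous _).intervalIntegrable _ _), integral_pow, integral_pow]
  push_cast
  simp only [one_pow]
  rw [zero_pow (by omega), zero_pow (by omega),
    show (j : ℝ) + 3 * p + 1 + 1 = j + 3 * p + 2 by ring]
  ring

theorem norm_kernelMoment_le (j : ℕ) : ‖kernelMoment j‖ ≤ 4 / 3 * (1 / ((j : ℝ) + 1)) := by
  have h := intervalIntegral.norm_integral_le_of_norm_le (μ := MeasureTheory.volume)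
    (f := fun t : ℝ => t ^ j / (1 - t + t ^ 2)) (g := fun t : ℝ => 4 / 3 * t ^ j) zero_le_one
    (Eventually.of_forall fun t ht => ?_) ((by fun_prop : Continuous _).intervalIntegrable _ _)
  · rwa [intervalIntegral.integral_const_mul, integral_pow, one_pow, zero_pow (by omega),
      sub_zero] at h
  · have hp : 0 ≤ t ^ j := pow_nonneg ht.1.le _
    have hr : 3 / 4 ≤ 1 - t + t ^ 2 := by nlinarith [sq_nonneg (t - 1 / 2)]
    rw [norm_div, Real.norm_of_nonneg hp, Real.norm_of_nonneg (one_sub_add_sq_pos t).le,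
      div_le_iff₀ (one_sub_add_sq_pos t)]
    nlinarith

/-- Each moment K(3m(n+1)) occurs in two consecutive terms with opposite signs, leaving the
coefficient H_{n+1} - H_n = 1/(n+1). -/
theorem sum_seriesTerm {m : ℕ} (hm : Odd m) (N : ℕ) :
    ∑ n ∈ Finset.Icc 1 N, seriesTerm m n
      = ∑ n ∈ Finset.range N, (-1) ^ n / ((n : ℝ) + 1) * kernelMoment (3 * m * (n + 1))
        + (-1) ^ (N + 1) * ((harmonic N : ℚ) : ℝ) * kernelMoment (3 * m * (N + 1)) := by
  induction N with
  | zero => simp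
  | succ N ih =>
    have ht : seriesTerm m (N + 1) = (-1) ^ (N + 1 + 1) * ((harmonic (N + 1) : ℚ) : ℝ) *
        (kernelMoment (3 * m * (N + 1)) + kernelMoment (3 * m * (N + 1 + 1))) := by
      rw [show 3 * m * (N + 1 + 1) = 3 * m * (N + 1) + 3 * m by ring, kernelMoment_add m _ hm,
        seriesTerm]
      push_cast
      rfl
    rw [Finset.sum_Icc_succ_top (by omega), ih, ht, Finset.sum_range_succ, harmonic_succ]
    push_cast
    field_simp
    ring

theorem tendsto_sum_kernelMoment {m : ℕ} :
    Tendsto (fun N : ℕ => ∑ n ∈ Finset.range N,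
        (-1) ^ n / ((n : ℝ) + 1) * kernelMoment (3 * m * (n + 1))) atTop
      (𝓝 (∫ t in (0 : ℝ)..1, Real.log (1 + t ^ (3 * m)) / (1 - t + t ^ 2))) := by
  have hlog : IntervalIntegrable (fun t : ℝ => Real.log (1 + t ^ (3 * m)) / (1 - t + t ^ 2))
      MeasureTheory.volume 0 1 :=
    intervalIntegrable_div_one_sub_add_sq (ContinuousOn.log (by fun_prop) fun t ht => by
      have := pow_nonneg ht.1 (3 * m)
      positivity)
  have hpoly : ∀ N : ℕ, IntervalIntegrable (fun t : ℝ => (∑ n ∈ Finset.range N,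
      (-1) ^ n / ((n : ℝ) + 1) * (t ^ (3 * m)) ^ (n + 1)) / (1 - t + t ^ 2))
      MeasureTheory.volume 0 1 := fun N => intervalIntegrable_div_one_sub_add_sq (by fun_prop)
  have hS : ∀ N : ℕ, ∑ n ∈ Finset.range N,
      (-1) ^ n / ((n : ℝ) + 1) * kernelMoment (3 * m * (n + 1))
      = ∫ t in (0 : ℝ)..1, (∑ n ∈ Finset.range N,
        (-1) ^ n / ((n : ℝ) + 1) * (t ^ (3 * m)) ^ (n + 1)) / (1 - t + t ^ 2) := by
    intro N
    have e : ∀ t : ℝ, (∑ n ∈ Finset.range N,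
        (-1) ^ n / ((n : ℝ) + 1) * (t ^ (3 * m)) ^ (n + 1)) / (1 - t + t ^ 2)
        = ∑ n ∈ Finset.range N,
          (-1) ^ n / ((n : ℝ) + 1) * (t ^ (3 * m * (n + 1)) / (1 - t + t ^ 2)) := by
      intro t
      rw [Finset.sum_div]
      exact Finset.sum_congr rfl fun n _ => by
        rw [pow_mul t (3 * m), mul_div_assoc]
    rw [intervalIntegral.integral_congr fun t _ => e t, intervalIntegral.integral_finsetSum
      fun n _ => (intervalIntegrable_pow_div _).const_mul _]
    exact Finset.sum_congr rfl fun n _ => (intervalIntegral.integral_const_mul _ _).symm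
  simp only [hS]
  rw [← tendsto_sub_nhds_zero_iff]
  refine squeeze_zero_norm (a := fun N : ℕ => 4 / 3 * (1 / ((N : ℝ) + 1))) (fun N => ?_)
    (by simpa using (tendsto_one_div_add_atTop_nhds_zero_nat (𝕜 := ℝ)).const_mul (4 / 3))
  rw [← intervalIntegral.integral_sub (hpoly N) hlog]
  refine (intervalIntegral.norm_integral_le_of_norm_le_const
    (C := 4 / 3 * (1 / ((N : ℝ) + 1))) fun t ht => ?_).trans (by simp)
  rw [uIoc_of_le zero_le_one] at ht
  have hr : 3 / 4 ≤ 1 - t + t ^ 2 := by nlinarith [sq_nonneg (t - 1 / 2)]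
  have h := abs_log_one_add_sub_sum_le N (pow_nonneg ht.1.le (3 * m))
    (pow_le_one₀ ht.1.le ht.2)
  rw [← sub_div, norm_div, norm_sub_rev, Real.norm_of_nonneg (one_sub_add_sq_pos t).le,
    div_le_iff₀ (one_sub_add_sq_pos t), Real.norm_eq_abs]
  refine h.trans ?_
  have : 0 < 1 / ((N : ℝ) + 1) := by positivity
  nlinarith

theorem tendsto_harmonic_mul_kernelMoment {m : ℕ} (hm : m ≠ 0) :
    Tendsto (fun N : ℕ => (-1) ^ (N + 1) * ((harmonic N : ℚ) : ℝ) * kernelMoment (3 * m * (N + 1)))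
      atTop (𝓝 0) := by
  have hlim : Tendsto (fun N : ℕ => 4 / 3 * ((1 : ℝ) / N + Real.log N / N)) atTop (𝓝 0) := by
    have h1 := Real.isLittleO_log_id_atTop.tendsto_div_nhds_zero.comp
      (tendsto_natCast_atTop_atTop (R := ℝ))
    simpa using! ((tendsto_one_div_atTop_nhds_zero_nat (𝕜 := ℝ)).add h1).const_mul (4 / 3)
  refine squeeze_zero_norm' ?_ hlim
  filter_upwards [eventually_gt_atTop 0] with N hN
  have hN' : (0 : ℝ) < N := by exact_mod_cast hN
  have hH := harmonic_le_one_add_log N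
  have hH0 : (0 : ℝ) ≤ ((harmonic N : ℚ) : ℝ) := by exact_mod_cast (harmonic_pos hN.ne').le
  rw [norm_mul, norm_mul, norm_pow, norm_neg, norm_one, one_pow, one_mul, Real.norm_of_nonneg hH0]
  have hk : ‖kernelMoment (3 * m * (N + 1))‖ ≤ 4 / 3 * (1 / (N : ℝ)) := by
    refine (norm_kernelMoment_le _).trans ?_
    have : N ≤ 3 * m * (N + 1) := by nlinarith [Nat.pos_of_ne_zero hm]
    have : (N : ℝ) ≤ ((3 * m * (N + 1) : ℕ) : ℝ) := by exact_mod_cast this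
    gcongr
    linarith
  calc ((harmonic N : ℚ) : ℝ) * ‖kernelMoment (3 * m * (N + 1))‖
      ≤ (1 + Real.log N) * (4 / 3 * (1 / (N : ℝ))) := by gcongr
    _ = 4 / 3 * ((1 : ℝ) / N + Real.log N / N) := by ring

/-! ### Agreement with the stated closed form -/

/-- For u = 6p the arcsine is 3p, because (1 - cos u)/2 = sin²(3p) and 0 < 3p < π/2. Then sin 3p =
sin p (1 + 2cos 2p) makes log sin p cancel. -/
theorem closedForm_term {u : ℝ} (h0 : 0 < u) (h1 : u < Real.pi) :
    2 * Real.log (Real.sin (1 / 3 * Real.arcsin √((-Real.cos u + 1) / 2)))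
      - Real.log (2 * Real.cos (2 / 3 * Real.arcsin √((1 + -Real.cos u) / 2)) + 1)
      - Real.log (1 + -Real.cos u)
      = -3 * Real.log (1 + 2 * Real.cos (u / 3)) - Real.log 2 := by
  obtain ⟨p, rfl⟩ : ∃ p, u = 6 * p := ⟨u / 6, by ring⟩
  have hpi := Real.pi_pos
  have hs : 0 < Real.sin p := Real.sin_pos_of_pos_of_lt_pi (by linarith) (by linarith)
  have hs3 : 0 < Real.sin (3 * p) := Real.sin_pos_of_pos_of_lt_pi (by linarith) (by linarith)
  have hc : 0 < Real.cos (2 * p) := Real.cos_pos_of_mem_Ioo ⟨by linarith, by linarith⟩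
  have e1 : -Real.cos (6 * p) = 2 * Real.sin (3 * p) ^ 2 - 1 := by
    rw [show 6 * p = 2 * (3 * p) by ring, Real.cos_two_mul, Real.cos_sq']; ring
  have e3 : Real.sin (3 * p) = Real.sin p * (1 + 2 * Real.cos (2 * p)) := by
    rw [Real.sin_three_mul, Real.cos_two_mul, Real.cos_sq']; ring
  have e2 : Real.arcsin √(Real.sin (3 * p) ^ 2) = 3 * p := by
    rw [Real.sqrt_sq hs3.le, Real.arcsin_sin (by linarith) (by linarith)]
  rw [e1, show (2 * Real.sin (3 * p) ^ 2 - 1 + 1) / 2 = Real.sin (3 * p) ^ 2 by ring,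
    show (1 + (2 * Real.sin (3 * p) ^ 2 - 1)) / 2 = Real.sin (3 * p) ^ 2 by ring, e2,
    show 1 + (2 * Real.sin (3 * p) ^ 2 - 1) = 2 * Real.sin (3 * p) ^ 2 by ring,
    show 1 / 3 * (3 * p) = p by ring, show 2 / 3 * (3 * p) = 2 * p by ring,
    show 6 * p / 3 = 2 * p by ring, Real.log_mul two_ne_zero (by positivity), Real.log_pow, e3,
    Real.log_mul hs.ne' (by positivity), add_comm (2 * Real.cos (2 * p))]
  push_cast
  ring

theorem integral_eq_closedForm {m : ℕ} (hm : Odd m) :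
    ∫ t in (0 : ℝ)..1, Real.log (1 + t ^ (3 * m)) / (1 - t + t ^ 2) = closedForm m := by
  rw [integral_log_one_add_pow hm, integral_log_div_eq_psiDeriv, closedForm,
    Finset.mul_sum _ _ (2 : ℝ), ← Finset.sum_sub_distrib, ← Finset.sum_sub_distrib]
  have e : ∀ k ∈ Finset.range ((m - 1) / 2),
      2 * Real.log (Real.sin (1 / 3 * Real.arcsin √((phi m k + 1) / 2)))
        - Real.log (2 * Real.cos (2 / 3 * Real.arcsin √((1 + phi m k) / 2)) + 1)
        - Real.log (1 + phi m k)
      = -3 * Real.log (1 + 2 * Real.cos ((Real.pi - (2 * (k : ℝ) + 1) * Real.pi / m) / 3))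
        - Real.log 2 := by
    intro k hk
    have hu := mem_Ioo_of_lt_half (Finset.mem_range.1 hk)
    rw [← closedForm_term hu.1 hu.2, Real.cos_pi_sub, neg_neg, phi]
  rw [Finset.sum_congr rfl e, Finset.sum_sub_distrib, ← Finset.mul_sum, Finset.sum_const,
    Finset.card_range, nsmul_eq_mul]
  have hmr : (m : ℝ) = 2 * (((m - 1) / 2 : ℕ) : ℝ) + 1 := by
    obtain ⟨r, rfl⟩ := hm
    rw [show (2 * r + 1 - 1) / 2 = r by omega]
    push_cast
    ring
  linear_combination (Real.pi * √3 / 9 * Real.log 2) * hmr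

theorem theorem3p2 (m : ℕ) (hm : Odd m) :
    Filter.Tendsto (fun N : ℕ => ∑ n ∈ Finset.Icc 1 N, seriesTerm m n)
      Filter.atTop (nhds (closedForm m)) := by
  have h := (tendsto_sum_kernelMoment (m := m)).add
    (tendsto_harmonic_mul_kernelMoment hm.pos.ne')
  rw [integral_eq_closedForm hm, add_zero] at h
  exact h.congr fun N => (sum_seriesTerm hm N).symm
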